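/- Let $\mathbb N=\{1,2,\dots\}$ and let $(a_k)_{k\in\mathbb N}$ be a sequence in $(-1,1)$. On $\{0,1\}^{\mathbb Z}$ let $P=\prod_{k\in\mathbb Z}P_k$ be the half-stationary product measure with $P_k(0)=1-P_k(1)=\frac{1-a_k}{2}$ for $k\ge 1$ and $P_k(0)=P_k(1)=\frac12$ for $k\le 0$, and let $T$ be the shift $(Tx)_k=x_{k+1}$. Let $P^+=\prod_{k\ge1}P_k$ on $\{0,1\}^{\mathbb N}$, and let $\tau$ be the odometer on $\{0,1\}^{\mathbb N}$, $\tau(1,\dots,1,0,w)=(0,\dots,0,1,w)$ and $\tau(1,1,1,\dots)=(0,0,0,\dots)$. Assume that $T$ is nonsingular for $P$ (that is, $P$ and $T_*P$ have the same null sets) and conservative (every measurable set of positive $P$-measure contains a point that returns to the set under some $T^n$, $n\ge1$; equivalently, there is no wandering set of positive measure), and that there is no $T$-invariant probability measure absolutely continuous with respect to $P$. Then: 1. There is a strictly increasing sequence $n_1<n_2<\cdots$ in $\mathbb N$ with $\lim_{k\to\infty}a_{n_k}=0$. 2. The odometer $(\{0,1\}^{\mathbb N},P^+,\tau)$ is of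 Krieger type $\mathrm{III}_1$: it is nonsingular and ergodic, and $e(\tau,\log\tau')=\mathbb R$, where $\tau'=\frac{dP^+\circ\tau}{dP^+}$. Here, for $\varphi:\{0,1\}^{\mathbb N}\to\mathbb R$, with $\varphi_n=\sum_{j=0}^{n-1}\varphi\circ\tau^j$, the set $e(\tau,\varphi)$ of essential values consists of all $t\in\mathbb R$ such that for every $\varepsilon>0$ and every measurable $A$ with $P^+(A)>0$ there is $n\ge1$ with $P^+\bigl(A\cap\tau^{-n}A\cap\{|\varphi_n-t|<\varepsilon\}\bigr)>0$. -/

import Mathlib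

open MeasureTheory Filter Topology

/-! ### Nonsingular ergodic theory -/

section General

variable {X : Type*} [MeasurableSpace X]

/-- An invertible bimeasurable map `T` is nonsingular for `μ` if `μ` and `T_* μ` have the same
null sets. -/
def IsNonsingular (T : X ≃ᵐ X) (μ : Measure X) : Prop :=
  μ.map T ≪ μ ∧ μ ≪ μ.map T

/-- The Radon–Nikodym derivative `T' = d(μ ∘ T) / dμ`; here `μ ∘ T : A ↦ μ (T A)` is the
push-forward of `μ` under `T⁻¹`. -/
noncomputable def rnDerivAlong (T : X ≃ᵐ X) (μ : Measure X) (x : X) : ℝ :=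
  ((μ.map T.symm).rnDeriv μ x).toReal

/-- The Radon–Nikodym cocycle `log T'`. -/
noncomputable def logRnDeriv (T : X ≃ᵐ X) (μ : Measure X) (x : X) : ℝ :=
  Real.log (rnDerivAlong T μ x)

/-- The set `e(T, φ)` of essential values: all `t` such that for every `ε > 0` and every measurable
`A` of positive measure there is `n ≥ 1` with `μ (A ∩ T⁻ⁿ A ∩ [|φ_n - t| < ε]) > 0`, where
`φ_n = φ + φ ∘ T + ⋯ + φ ∘ Tⁿ⁻¹`. -/
def essentialValues (T : X → X) (μ : Measure X) (φ : X → ℝ) : Set ℝ :=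
  {t | ∀ ε : ℝ, 0 < ε → ∀ A : Set X, MeasurableSet A → 0 < μ A →
    ∃ n : ℕ, 1 ≤ n ∧ 0 < μ (A ∩ T^[n] ⁻¹' A ∩ {x | |birkhoffSum T φ n x - t| < ε})}

/-- Krieger type `III₁`: `T` is nonsingular and ergodic, and every real number is an essential
value of the Radon–Nikodym cocycle. -/
def IsTypeIIIOne (T : X ≃ᵐ X) (μ : Measure X) : Prop :=
  IsNonsingular T μ ∧ QuasiErgodic T μ ∧ essentialValues T μ (logRnDeriv T μ) = Set.univ

/-- There is an absolutely continuous `T`-invariant probability measure. -/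
def HasACIP (T : X → X) (μ : Measure X) : Prop :=
  ∃ ν : Measure X, IsProbabilityMeasure ν ∧ ν ≪ μ ∧ MeasurePreserving T ν ν

end General

/-! ### Half-stationary product measures and the full shift -/

/-- The measure on `{0, 1}` with mass `(1 - q) / 2` at `0` and `(1 + q) / 2` at `1`. -/
noncomputable def coin (q : Set.Ioo (-1 : ℝ) 1) : Measure (Fin 2) :=
  ENNReal.ofReal ((1 - (q : ℝ)) / 2) • Measure.dirac 0 +
    ENNReal.ofReal ((1 + (q : ℝ)) / 2) • Measure.dirac 1

instance coin.instIsProbabilityMeasure (q : Set.Ioo (-1 : ℝ) 1) :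
    IsProbabilityMeasure (coin q) := by
  obtain ⟨q, h1, h2⟩ := q
  constructor
  simp only [coin, Measure.add_apply, Measure.smul_apply, measure_univ, smul_eq_mul, mul_one]
  rw [← ENNReal.ofReal_add (by linarith) (by linarith), ← ENNReal.ofReal_one]
  congr 1
  ring

/-- The two-sided parameter sequence: `a k` for `k ≥ 1` and `0` for `k ≤ 0`. -/
noncomputable def twoSided (a : ℕ+ → Set.Ioo (-1 : ℝ) 1) (k : ℤ) : Set.Ioo (-1 : ℝ) 1 :=
  if h : 0 < k then a ⟨k.toNat, by omega⟩ else ⟨0, by norm_num⟩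

/-- The half-stationary product measure `P = ∏_{k ∈ ℤ} P_k` on `{0,1}^ℤ`: `P_k(0) = (1 - a_k)/2`
for `k ≥ 1` and `P_k(0) = 1/2` for `k ≤ 0`. -/
noncomputable def halfStationaryMeasure (a : ℕ+ → Set.Ioo (-1 : ℝ) 1) : Measure (ℤ → Fin 2) :=
  Measure.infinitePi fun k : ℤ => coin (twoSided a k)

/-- The one-sided product measure `P⁺ = ∏_{k ≥ 1} P_k` on `{0,1}^ℕ`, `ℕ = {1, 2, …}`. -/
noncomputable def oneSidedMeasure (a : ℕ+ → Set.Ioo (-1 : ℝ) 1) : Measure (ℕ+ → Fin 2) :=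
  Measure.infinitePi fun k : ℕ+ => coin (a k)

/-- The full shift `(T x)_k = x_{k+1}` on `{0,1}^ℤ`. -/
def fullShift : (ℤ → Fin 2) ≃ᵐ (ℤ → Fin 2) where
  toFun x k := x (k + 1)
  invFun x k := x (k - 1)
  left_inv x := by funext k; simp
  right_inv x := by funext k; simp
  measurable_toFun := measurable_pi_lambda _ fun k => measurable_pi_apply (k + 1)
  measurable_invFun := measurable_pi_lambda _ fun k => measurable_pi_apply (k - 1)

/-! ### The odometer -/

open Classical in
/-- Flip the coordinate `x_n` exactly when `x_m = c` for all `m < n`. For `c = 1` this is addition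
of one with carry, `(1,…,1,0,w) ↦ (0,…,0,1,w)` and `(1,1,…) ↦ (0,0,…)`; for `c = 0` it is the
inverse, subtraction of one with borrow. -/
noncomputable def carryMap (c : Fin 2) (x : ℕ+ → Fin 2) (n : ℕ+) : Fin 2 :=
  if ∀ m < n, x m = c then 1 - x n else x n

theorem carryMap_prefix (c : Fin 2) (x : ℕ+ → Fin 2) (n : ℕ+) :
    (∀ m < n, carryMap c x m = 1 - c) ↔ ∀ m < n, x m = c := by
  constructor
  · intro h m
    induction m using WellFoundedLT.induction with
    | ind m ih =>
      intro hm
      have h1 := h m hm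
      rw [carryMap, if_pos fun j hj => ih j hj (hj.trans hm)] at h1
      exact sub_right_injective h1
  · intro h m hm
    rw [carryMap, if_pos fun j hj => h j (hj.trans hm), h m hm]

theorem carryMap_carryMap (c : Fin 2) (x : ℕ+ → Fin 2) :
    carryMap (1 - c) (carryMap c x) = x := by
  funext n
  by_cases h : ∀ m < n, x m = c
  · rw [carryMap, if_pos ((carryMap_prefix c x n).2 h), carryMap, if_pos h, sub_sub_cancel]
  · rw [carryMap, if_neg fun h' => h ((carryMap_prefix c x n).1 h'), carryMap, if_neg h]

theorem measurable_carryMap (c : Fin 2) : Measurable (carryMap c) := by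
  refine measurable_pi_lambda _ fun n => ?_
  unfold carryMap
  refine Measurable.ite ?_ ?_ (measurable_pi_apply n)
  · have : {x : ℕ+ → Fin 2 | ∀ m < n, x m = c} = ⋂ m, ⋂ (_ : m < n), {x | x m = c} := by
      ext x; simp
    rw [this]
    exact MeasurableSet.iInter fun m => MeasurableSet.iInter fun _ =>
      measurableSet_eq_fun (measurable_pi_apply m) measurable_const
  · exact (measurable_of_countable fun i : Fin 2 => 1 - i).comp (measurable_pi_apply n)

/-- The odometer `τ (1,…,1,0,w) = (0,…,0,1,w)` on `{0,1}^ℕ`, with `τ (1,1,…) = (0,0,…)`. -/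
noncomputable def odometer : (ℕ+ → Fin 2) ≃ᵐ (ℕ+ → Fin 2) where
  toFun := carryMap 1
  invFun := carryMap 0
  left_inv x := by simpa using carryMap_carryMap 1 x
  right_inv x := by simpa using carryMap_carryMap 0 x
  measurable_toFun := measurable_carryMap 1
  measurable_invFun := measurable_carryMap 0

/-! Three facts about the biases follow from the hypotheses on the shift. Nonsingularity forces
`a_{n+1} - a_n → 0`, because a spin sum over many indices with a large jump would otherwise separate
`P` from `T_* P`. Conservativity then forces `0` to be a limit point: with small jumps, biases
bounded away from `0` eventually keep one sign, and a shifted point would show biased averages on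
the fair half. Finally `∑ a_k ^ 2 = ∞`, since otherwise Kakutani's criterion makes the fair
Bernoulli measure an absolutely continuous invariant probability. Together they give the real input:
for every `η > 0`, the squares of the biases with `|a_k| ≤ η` already have infinite sum.

For the odometer, the cocycle along an orbit segment is the logarithm of a ratio of masses of finite
words, so a finite flip of the set `G` contributes `-energy G`. Given `A`, approximate it by a
cylinder over `I` and take a finite `F` disjoint from `I` with tiny log-odds and large `∑ a_k ^ 2`.
By a Chernoff bound the energy over `F` exceeds `t` with probability at least `1/2`; its partial
sums move in tiny steps, so at the first crossing the energy is almost exactly `t`. Flipping the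
coordinates of `F` up to the crossing, with one further coordinate `j` beyond `I` and `F`, keeps the
cylinder. It inflates measure by a bounded factor only (`sum_measure_crossing_inter_preimage_le`),
so some flip returns from `A` to `A` on a set of positive measure. The digit `x_j` decides whether
the flip is a forward or a backward iterate, which yields both `t` and `-t`
(`spin_mul_mem_essentialValues`). -/

open ProbabilityTheory Set
open scoped ENNReal

/-! ### Coins, spins and log-odds -/

/-- The spin `±1` of a symbol. -/
def spin (i : Fin 2) : ℝ := if i = 1 then 1 else -1

@[simp] theorem spin_zero : spin 0 = -1 := by simp [spin]

@[simp] theorem spin_one : spin 1 = 1 := by simp [spin]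

theorem spin_one_sub (i : Fin 2) : spin (1 - i) = -spin i := by
  fin_cases i <;> simp

theorem abs_spin (i : Fin 2) : |spin i| = 1 := by
  fin_cases i <;> simp

@[fun_prop] theorem measurable_spin : Measurable spin := measurable_of_countable _

/-- The log-odds of the symbol `1` for the measure `coin q`. -/
noncomputable def logOdds (q : ℝ) : ℝ := Real.log ((1 + q) / (1 - q))

theorem exp_logOdds (q : Ioo (-1 : ℝ) 1) : Real.exp (logOdds q) = (1 + q) / (1 - q) := by
  obtain ⟨q, h1, h2⟩ := q
  exact Real.exp_log (div_pos (by linarith) (by linarith))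

theorem continuousAt_logOdds_zero : ContinuousAt logOdds 0 := by
  unfold logOdds
  refine ContinuousAt.log (ContinuousAt.div ?_ ?_ ?_) ?_ <;> first | fun_prop | norm_num

@[simp] theorem logOdds_zero : logOdds 0 = 0 := by simp [logOdds]

theorem lintegral_coin (q : Ioo (-1 : ℝ) 1) (f : Fin 2 → ℝ≥0∞) :
    ∫⁻ i, f i ∂coin q =
      ENNReal.ofReal ((1 - q) / 2) * f 0 + ENNReal.ofReal ((1 + q) / 2) * f 1 := by
  simp [coin, lintegral_add_measure, lintegral_smul_measure]

theorem integral_spin_coin (q : Ioo (-1 : ℝ) 1) : ∫ i, spin i ∂coin q = q := by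
  obtain ⟨q, h1, h2⟩ := q
  have hi : ∀ (r : ℝ) (i : Fin 2), Integrable spin (ENNReal.ofReal r • Measure.dirac i) :=
    fun r i => (integrable_dirac (by simp)).smul_measure ENNReal.ofReal_ne_top
  rw [coin, integral_add_measure (hi _ _) (hi _ _), integral_smul_measure, integral_smul_measure]
  simp only [integral_dirac, spin_zero, spin_one, smul_eq_mul]
  rw [ENNReal.toReal_ofReal (by linarith), ENNReal.toReal_ofReal (by linarith)]
  ring

theorem coin_singleton (q : Ioo (-1 : ℝ) 1) (i : Fin 2) :
    coin q {i} = ENNReal.ofReal ((1 + q * spin i) / 2) := by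
  rw [← lintegral_indicator_one (measurableSet_singleton i), lintegral_coin]
  fin_cases i <;> simp [sub_eq_add_neg]

theorem map_coin_one_sub (q : Ioo (-1 : ℝ) 1) :
    (coin q).map (fun i => 1 - i) =
      (coin q).withDensity fun i => ENNReal.ofReal (Real.exp (-(logOdds q * spin i))) := by
  refine Measure.ext_of_singleton fun i => ?_
  have hq := exp_logOdds q
  have hq' : Real.exp (-logOdds q) = (1 - q) / (1 + q) := by rw [Real.exp_neg, hq, inv_div]
  obtain ⟨q, h1, h2⟩ := q
  simp only at hq hq'
  have h3 : 0 < 1 + q := by linarith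
  have h4 : 0 < 1 - q := by linarith
  rw [withDensity_apply _ (measurableSet_singleton i),
    Measure.map_apply (measurable_of_countable _) (measurableSet_singleton i),
    lintegral_singleton, coin_singleton]
  have : (fun i : Fin 2 => 1 - i) ⁻¹' {i} = {1 - i} := by
    ext j; fin_cases i <;> fin_cases j <;> simp
  rw [this, coin_singleton, spin_one_sub, ← ENNReal.ofReal_mul (Real.exp_pos _).le]
  congr 1
  fin_cases i
  · simp only [Fin.zero_eta, spin_zero, mul_neg, mul_one, neg_neg, hq]
    field_simp
    ring
  · simp only [Fin.mk_one, spin_one, mul_neg, mul_one, hq']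
    field_simp
    ring

/-! ### Finite flips, energies and concentration -/

section Flip

variable {ι : Type*} [DecidableEq ι]

/-- Flip the coordinates in the finite set `G`. -/
def flipOn (G : Finset ι) (x : ι → Fin 2) (k : ι) : Fin 2 := if k ∈ G then 1 - x k else x k

theorem flipOn_flipOn (G : Finset ι) (x : ι → Fin 2) : flipOn G (flipOn G x) = x := by
  funext k
  by_cases h : k ∈ G <;> simp [flipOn, h]

@[fun_prop] theorem measurable_flipOn (G : Finset ι) : Measurable (flipOn G) := by
  refine measurable_pi_lambda _ fun k => ?_
  unfold flipOn
  split_ifs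
  · exact (measurable_of_countable fun i : Fin 2 => 1 - i).comp (measurable_pi_apply k)
  · exact measurable_pi_apply k

end Flip

section Energy

variable {ι : Type*} (b : ι → Ioo (-1 : ℝ) 1)

/-- The change of `-log` of the mass of the configuration when the coordinates in `G` are
flipped. -/
noncomputable def energy (G : Finset ι) (x : ι → Fin 2) : ℝ :=
  ∑ k ∈ G, logOdds (b k) * spin (x k)

@[fun_prop] theorem measurable_energy (G : Finset ι) : Measurable (energy b G) := by
  unfold energy
  fun_prop

theorem energy_flipOn_of_subset [DecidableEq ι] {F G : Finset ι} (h : F ⊆ G) (x : ι → Fin 2) :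
    energy b F (flipOn G x) = -energy b F x := by
  rw [energy, energy, ← Finset.sum_neg_distrib]
  refine Finset.sum_congr rfl fun k hk => ?_
  rw [flipOn, if_pos (h hk), spin_one_sub, mul_neg]

theorem lintegral_prod_infinitePi_coin (s : Finset ι) (f : ι → Fin 2 → ℝ≥0∞) :
    ∫⁻ x, ∏ i ∈ s, f i (x i) ∂Measure.infinitePi (fun k => coin (b k)) =
      ∏ i ∈ s, ∫⁻ j, f i j ∂coin (b i) := by
  have h := lintegral_prod_eq_prod_lintegral_of_indepFun s (fun i (x : ι → Fin 2) => f i (x i))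
    (iIndepFun_infinitePi (P := fun k => coin (b k)) (X := f) fun i => measurable_of_countable _)
    fun i => (measurable_of_countable (f i)).comp (measurable_pi_apply i)
  rw [h]
  refine Finset.prod_congr rfl fun i _ => ?_
  rw [← Measure.infinitePi_map_eval (fun k => coin (b k)) i,
    lintegral_map (measurable_of_countable _) (measurable_pi_apply i)]

/-- Replacing finitely many factors of a product of coins by equivalent ones changes the product
by the product of the densities. -/
theorem infinitePi_eq_withDensity (G : Finset ι) (ν : ι → Measure (Fin 2))
    [∀ k, IsProbabilityMeasure (ν k)] (w : ι → Fin 2 → ℝ≥0∞)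
    (hw : ∀ k ∈ G, ν k = (coin (b k)).withDensity (w k)) (hν : ∀ k ∉ G, ν k = coin (b k)) :
    Measure.infinitePi ν =
      (Measure.infinitePi fun k => coin (b k)).withDensity fun x => ∏ k ∈ G, w k (x k) := by
  symm
  refine Measure.eq_infinitePi _ fun s t ht => ?_
  have hm : MeasurableSet (Set.pi (s : Set ι) t) :=
    MeasurableSet.pi s.countable_toSet fun i _ => ht i
  classical
  let g : ι → Fin 2 → ℝ≥0∞ := fun k i =>
    (if k ∈ s then (t k).indicator 1 i else 1) * if k ∈ G then w k i else 1
  rw [withDensity_apply _ hm, ← lintegral_indicator hm]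
  have e1 : ∀ x, (Set.pi (s : Set ι) t).indicator (fun x => ∏ k ∈ G, w k (x k)) x =
      ∏ k ∈ s ∪ G, g k (x k) := by
    intro x
    simp only [g, Finset.prod_mul_distrib]
    rw [← Finset.prod_subset (Finset.subset_union_left : s ⊆ s ∪ G)
        (fun k _ hk => by simp [hk]), ← Finset.prod_subset
        (Finset.subset_union_right : G ⊆ s ∪ G) (fun k _ hk => by simp [hk]),
      Finset.prod_congr rfl fun k (hk : k ∈ G) => if_pos hk]
    by_cases hx : x ∈ Set.pi (s : Set ι) t
    · have h1 : ∏ k ∈ s, (if k ∈ s then (t k).indicator (1 : Fin 2 → ℝ≥0∞) (x k) else 1) = 1 :=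
        Finset.prod_eq_one fun k hk => by simp [hk, hx k hk]
      rw [indicator_of_mem hx, h1, one_mul]
    · rw [indicator_of_notMem hx]
      simp only [Set.mem_pi, not_forall] at hx
      obtain ⟨k, hk, hk'⟩ := hx
      rw [Finset.prod_eq_zero (i := k) hk (by simp [Finset.mem_coe.1 hk, hk']), zero_mul]
  have e2 : ∀ k, ν k = (coin (b k)).withDensity fun i => if k ∈ G then w k i else 1 := by
    intro k
    by_cases hk : k ∈ G
    · simpa [hk] using hw k hk
    · simp only [hk, if_false]
      rw [← Pi.one_def, withDensity_one, hν k hk]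
  simp_rw [e1]
  rw [lintegral_prod_infinitePi_coin, ← Finset.prod_subset
    (Finset.subset_union_left : s ⊆ s ∪ G)]
  · refine Finset.prod_congr rfl fun k hk => ?_
    rw [e2, withDensity_apply _ (ht k), ← lintegral_indicator (ht k)]
    refine lintegral_congr fun i => ?_
    by_cases hi : i ∈ t k <;> simp [g, hk, hi]
  · intro k _ hk
    have : g k = fun i => if k ∈ G then w k i else 1 := by funext i; simp [g, hk]
    rw [this, ← setLIntegral_univ, ← withDensity_apply _ MeasurableSet.univ, ← e2, measure_univ]

theorem map_flipOn [DecidableEq ι] (G : Finset ι) :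
    (Measure.infinitePi fun k => coin (b k)).map (flipOn G) =
      (Measure.infinitePi fun k => coin (b k)).withDensity
        fun x => ENNReal.ofReal (Real.exp (-energy b G x)) := by
  let f : ι → Fin 2 → Fin 2 := fun k i => if k ∈ G then 1 - i else i
  have hf : ∀ k, Measurable (f k) := fun k => measurable_of_countable _
  have hp : ∀ k, IsProbabilityMeasure ((coin (b k)).map (f k)) := fun k =>
    Measure.isProbabilityMeasure_map (hf k).aemeasurable
  have h := Measure.infinitePi_map_pi (fun k => coin (b k)) hf
  change Measure.map (flipOn G) _ = _ at h
  rw [h, infinitePi_eq_withDensity b G _ fun k i =>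
    ENNReal.ofReal (Real.exp (-(logOdds (b k) * spin i)))]
  · congr 1
    funext x
    rw [energy, ← Finset.sum_neg_distrib, Real.exp_sum,
      ENNReal.ofReal_prod_of_nonneg fun i _ => (Real.exp_pos _).le]
  · intro k hk
    simpa [f, hk] using map_coin_one_sub (b k)
  · intro k hk
    simp only [f, hk, if_false]
    rw [Measure.map_id']

theorem measure_flipOn_preimage_eq_zero [DecidableEq ι] (G : Finset ι) {B : Set (ι → Fin 2)}
    (hB : MeasurableSet B) (h : Measure.infinitePi (fun k => coin (b k)) B = 0) :
    Measure.infinitePi (fun k => coin (b k)) (flipOn G ⁻¹' B) = 0 := by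
  rw [← Measure.map_apply (measurable_flipOn G) hB, map_flipOn]
  exact withDensity_absolutelyContinuous _ _ h

/-- Chernoff bound for the probability that the energy is small. -/
theorem measure_energy_lt_le (F : Finset ι) (t : ℝ) :
    Measure.infinitePi (fun k => coin (b k)) {x | energy b F x < t} ≤
      ENNReal.ofReal (Real.exp (t / 2 - (∑ k ∈ F, (b k : ℝ) ^ 2) / 2)) := by
  -- Exponent `1/2`: the mean of `exp (-energy / 2)` is the product of the affinities `√(1 - b_k ^
  -- 2) ≤ exp (-b_k ^ 2 / 2)`.
  let g : ι → Fin 2 → ℝ≥0∞ := fun k i =>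
    ENNReal.ofReal (Real.exp (-(logOdds (b k) * spin i) / 2))
  have hg : ∀ x, ∏ k ∈ F, g k (x k) = ENNReal.ofReal (Real.exp (-energy b F x / 2)) := by
    intro x
    rw [energy, ← Finset.sum_neg_distrib, Finset.sum_div, Real.exp_sum,
      ENNReal.ofReal_prod_of_nonneg fun i _ => (Real.exp_pos _).le]
  have hk : ∀ k, ∫⁻ i, g k i ∂coin (b k) ≤ ENNReal.ofReal (Real.exp (-(b k : ℝ) ^ 2 / 2)) := by
    intro k
    have hq : Real.exp (logOdds (b k) / 2) = Real.sqrt ((1 + b k) / (1 - b k)) := by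
      rw [← exp_logOdds, Real.exp_half]
    have hq' : Real.exp (-logOdds (b k) / 2) = Real.sqrt ((1 - b k) / (1 + b k)) := by
      rw [← inv_div (1 + (b k : ℝ)), ← exp_logOdds, ← Real.exp_neg, Real.exp_half]
    rw [lintegral_coin]
    simp only [g, spin_zero, spin_one, mul_neg, mul_one, neg_neg, hq, hq']
    obtain ⟨q, h1, h2⟩ := b k
    simp only
    rw [← ENNReal.ofReal_mul (by linarith), ← ENNReal.ofReal_mul (by linarith),
      ← ENNReal.ofReal_add (mul_nonneg (by linarith) (Real.sqrt_nonneg _))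
        (mul_nonneg (by linarith) (Real.sqrt_nonneg _))]
    refine ENNReal.ofReal_le_ofReal ?_
    have h3 : 0 < 1 + q := by linarith
    have h4 : 0 < 1 - q := by linarith
    rw [Real.sqrt_div' _ h3.le, Real.sqrt_div' _ h4.le]
    have e : (1 - q) / 2 * (Real.sqrt (1 + q) / Real.sqrt (1 - q)) +
        (1 + q) / 2 * (Real.sqrt (1 - q) / Real.sqrt (1 + q)) =
        Real.sqrt (1 - q) * Real.sqrt (1 + q) := by
      have s3 := Real.sqrt_pos.2 h3
      have s4 := Real.sqrt_pos.2 h4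
      have m3 := Real.mul_self_sqrt h3.le
      have m4 := Real.mul_self_sqrt h4.le
      field_simp
      rw [sq, sq, m3, m4]
      ring
    rw [e, ← Real.sqrt_mul h4.le, Real.exp_half (-q ^ 2)]
    exact Real.sqrt_le_sqrt (by nlinarith [Real.add_one_le_exp (-q ^ 2)])
  have hmk : ENNReal.ofReal (Real.exp (-t / 2)) *
      Measure.infinitePi (fun k => coin (b k)) {x | energy b F x < t} ≤
        ENNReal.ofReal (Real.exp (-(∑ k ∈ F, (b k : ℝ) ^ 2) / 2)) := by
    calc _ ≤ ENNReal.ofReal (Real.exp (-t / 2)) * Measure.infinitePi (fun k => coin (b k))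
          {x | ENNReal.ofReal (Real.exp (-t / 2)) ≤ ∏ k ∈ F, g k (x k)} := by
          gcongr with x
          intro hx
          rw [hg]
          exact ENNReal.ofReal_le_ofReal (Real.exp_le_exp.2 (by linarith))
      _ ≤ ∫⁻ x, ∏ k ∈ F, g k (x k) ∂Measure.infinitePi (fun k => coin (b k)) := by
          refine mul_meas_ge_le_lintegral ?_ _
          simp_rw [hg]
          fun_prop
      _ ≤ ∏ k ∈ F, ENNReal.ofReal (Real.exp (-(b k : ℝ) ^ 2 / 2)) := by
          rw [lintegral_prod_infinitePi_coin]
          exact Finset.prod_le_prod' fun k _ => hk k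
      _ = _ := by
          rw [← ENNReal.ofReal_prod_of_nonneg fun i _ => (Real.exp_pos _).le, ← Real.exp_sum,
            ← Finset.sum_div, Finset.sum_neg_distrib]
  have e : ENNReal.ofReal (Real.exp (t / 2)) * ENNReal.ofReal (Real.exp (-t / 2)) = 1 := by
    rw [← ENNReal.ofReal_mul (Real.exp_pos _).le, ← Real.exp_add]
    simp [neg_div]
  calc _ = ENNReal.ofReal (Real.exp (t / 2)) * (ENNReal.ofReal (Real.exp (-t / 2)) *
      Measure.infinitePi (fun k => coin (b k)) {x | energy b F x < t}) := by
        rw [← mul_assoc, e, one_mul]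
    _ ≤ ENNReal.ofReal (Real.exp (t / 2)) *
        ENNReal.ofReal (Real.exp (-(∑ k ∈ F, (b k : ℝ) ^ 2) / 2)) := by gcongr
    _ = _ := by
      rw [← ENNReal.ofReal_mul (Real.exp_pos _).le, ← Real.exp_add]
      congr 2
      ring

/-- Hoeffding's inequality for sums of spins. -/
theorem measure_sum_spin_ge_le (F : Finset ι) {c : ℝ} (hc : |c| = 1) {r : ℝ} (hr : 0 ≤ r) :
    (Measure.infinitePi fun k => coin (b k)).real
        {x | c * ∑ k ∈ F, (b k : ℝ) + r ≤ c * ∑ k ∈ F, spin (x k)} ≤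
      Real.exp (-r ^ 2 / (2 * F.card)) := by
  have hI := iIndepFun_infinitePi (P := fun k => coin (b k))
    (X := fun k i => c * spin i - c * (b k : ℝ)) fun i => by fun_prop
  have hc' : ∀ i, c * spin i ∈ Icc (-1 : ℝ) 1 := fun i => by
    rw [mem_Icc, ← abs_le, abs_mul, hc, abs_spin, one_mul]
  have hs : ∀ k ∈ F, HasSubgaussianMGF (fun x : ι → Fin 2 => c * spin (x k) - c * (b k : ℝ)) 1
      (Measure.infinitePi fun k => coin (b k)) := by
    intro k _
    have h := hasSubgaussianMGF_of_mem_Icc (μ := Measure.infinitePi fun k => coin (b k))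
      (X := fun x : ι → Fin 2 => c * spin (x k)) (a := -1) (b := 1)
      (measurable_spin.comp (measurable_pi_apply k) |>.const_mul c).aemeasurable
      (ae_of_all _ fun x => hc' _)
    have e1 : ∫ x, c * spin (x k) ∂Measure.infinitePi (fun k => coin (b k)) = c * (b k : ℝ) := by
      rw [integral_const_mul, ← integral_spin_coin,
        ← Measure.infinitePi_map_eval (fun k => coin (b k)) k, integral_map]
      · exact (measurable_pi_apply k).aemeasurable
      · exact measurable_spin.aestronglyMeasurable
    have e2 : ((‖(1 : ℝ) - -1‖₊ / 2) ^ 2 : NNReal) = 1 := by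
      ext
      norm_num
    rwa [e1, e2] at h
  have h := HasSubgaussianMGF.measure_sum_ge_le_of_iIndepFun hI hs hr
  have e : {x : ι → Fin 2 | c * ∑ k ∈ F, (b k : ℝ) + r ≤ c * ∑ k ∈ F, spin (x k)} =
      {x | r ≤ ∑ k ∈ F, (c * spin (x k) - c * (b k : ℝ))} := by
    ext x
    simp only [mem_ofPred_eq, Finset.sum_sub_distrib, ← Finset.mul_sum]
    constructor <;> intro h <;> linarith
  rw [e]
  simpa using h

/-- Events depending on disjoint sets of coordinates are independent. -/
theorem measure_inter_of_disjoint {I J : Finset ι} (hIJ : Disjoint I J)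
    {S : Set (I → Fin 2)} {T : Set (J → Fin 2)} (hS : MeasurableSet S) (hT : MeasurableSet T) :
    Measure.infinitePi (fun k => coin (b k)) (cylinder I S ∩ cylinder J T) =
      Measure.infinitePi (fun k => coin (b k)) (cylinder I S) *
        Measure.infinitePi (fun k => coin (b k)) (cylinder J T) := by
  have h := (iIndepFun_infinitePi (P := fun k => coin (b k)) (X := fun _ i => i)
    fun i => measurable_id).indepFun_finset I J hIJ fun i => measurable_pi_apply i
  exact h.measure_inter_preimage_eq_mul S T hS hT

theorem exists_cylinder_symmDiff_lt (μ : Measure (ι → Fin 2)) [IsFiniteMeasure μ]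
    {A : Set (ι → Fin 2)} (hA : MeasurableSet A) {ε : ℝ≥0∞} (hε : 0 < ε) :
    ∃ (I : Finset ι) (S : Set (I → Fin 2)), MeasurableSet S ∧ μ (symmDiff (cylinder I S) A) < ε := by
  obtain ⟨t, ht, h⟩ := exists_measure_symmDiff_lt_of_generateFrom_isSetRing (μ := μ)
    (isSetRing_measurableCylinders (α := fun _ : ι => Fin 2))
    ⟨{univ}, countable_singleton _, by simpa using univ_mem_measurableCylinders fun _ : ι => Fin 2,
      by simp⟩
    generateFrom_measurableCylinders.symm hA hε
  obtain ⟨I, S, hS, rfl⟩ := (mem_measurableCylinders t).1 ht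
  exact ⟨I, S, hS, h⟩

end Energy

/-! ### Kakutani's criterion by second moments -/

section Kakutani

variable {ι : Type*} (b : ι → Ioo (-1 : ℝ) 1)

/-- The fair coin. -/
def fair : Ioo (-1 : ℝ) 1 := ⟨0, by norm_num⟩

theorem coin_fair (q : Ioo (-1 : ℝ) 1) :
    coin fair = (coin q).withDensity fun i => ENNReal.ofReal (1 / (1 + q * spin i)) := by
  refine Measure.ext_of_singleton fun i => ?_
  rw [withDensity_apply _ (measurableSet_singleton i), lintegral_singleton, coin_singleton,
    coin_singleton]
  obtain ⟨q, h1, h2⟩ := q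
  have h : 0 < 1 + q * spin i := by
    have := abs_spin i
    rcases eq_or_eq_neg_of_abs_eq this with h | h <;> rw [h] <;> linarith
  simp only [fair]
  rw [← ENNReal.ofReal_mul (by positivity)]
  rw [zero_mul, add_zero]
  generalize 1 + q * spin i = u at h
  congr 1
  field_simp

theorem lintegral_coin_density_sq (q : Ioo (-1 : ℝ) 1) :
    ∫⁻ i, ENNReal.ofReal (1 / (1 + q * spin i)) ^ 2 ∂coin q =
      ENNReal.ofReal (1 + (q : ℝ) ^ 2 / (1 - (q : ℝ) ^ 2)) := by
  rw [lintegral_coin]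
  obtain ⟨q, h1, h2⟩ := q
  simp only [spin_zero, spin_one]
  have h3 : 0 < 1 + q := by linarith
  have h4 : 0 < 1 - q := by linarith
  have h5 : 1 - q ^ 2 = (1 + q) * (1 - q) := by ring
  have h6 : 0 < 1 + q * -1 := by linarith
  have h7 : 0 < 1 + q * 1 := by linarith
  rw [← ENNReal.ofReal_pow (by positivity), ← ENNReal.ofReal_pow (by positivity),
    ← ENNReal.ofReal_mul (by positivity), ← ENNReal.ofReal_mul (by positivity),
    ← ENNReal.ofReal_add (by positivity) (by positivity), h5]
  congr 1
  have e1 : 1 + q * -1 = 1 - q := by ring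
  rw [e1, mul_one]
  field_simp
  ring

theorem exists_prod_one_add_le {g : ι → ℝ} (hb : Summable g) (hg : ∀ k, 0 ≤ g k) :
    ∃ K : ℝ, ∀ I : Finset ι, ∏ k ∈ I, (1 + g k) ≤ K := by
  refine ⟨Real.exp (∑' k, g k), fun I => ?_⟩
  calc ∏ k ∈ I, (1 + g k) ≤ ∏ k ∈ I, Real.exp (g k) :=
        Finset.prod_le_prod (fun k _ => by linarith [hg k])
          fun k _ => by linarith [Real.add_one_le_exp (g k)]
    _ = Real.exp (∑ k ∈ I, g k) := (Real.exp_sum _ _).symm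
    _ ≤ _ := Real.exp_le_exp.2 (hb.sum_le_tsum _ fun k _ => hg k)

/-- One direction of Kakutani's theorem: the fair product measure is absolutely continuous with
respect to a product of coins with square summable biases. -/
theorem fair_absolutelyContinuous (hb : Summable fun k => (b k : ℝ) ^ 2) :
    Measure.infinitePi (fun _ : ι => coin fair) ≪ Measure.infinitePi fun k => coin (b k) := by
  set P := Measure.infinitePi fun k => coin (b k)
  set ν := Measure.infinitePi fun _ : ι => coin fair
  have hb1 : ∀ k, (b k : ℝ) ^ 2 < 1 := fun k => by
    have := (b k).2.1; have := (b k).2.2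
    nlinarith
  have hs : Summable fun k => (b k : ℝ) ^ 2 / (1 - (b k : ℝ) ^ 2) := by
    refine Summable.of_norm_bounded_eventually (hb.mul_left 2) ?_
    filter_upwards [hb.tendsto_cofinite_zero.eventually (gt_mem_nhds one_half_pos)] with k hk
    have h1 := hb1 k
    rw [Real.norm_of_nonneg (div_nonneg (sq_nonneg _) (by linarith)), div_le_iff₀ (by linarith)]
    nlinarith [sq_nonneg (b k : ℝ)]
  obtain ⟨K, hK⟩ := exists_prod_one_add_le hs fun k =>
    div_nonneg (sq_nonneg _) (by linarith [hb1 k])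
  -- On cylinders the density `w` satisfies `w ≤ δ w ^ 2 + δ⁻¹`, and its second moment `∏ (1 + b_k ^
  -- 2 / (1 - b_k ^ 2))` is at most `K` uniformly in `I`.
  have key : ∀ (I : Finset ι) (S : Set (I → Fin 2)), MeasurableSet S → ∀ δ : ℝ, 0 < δ →
      ν (cylinder I S) ≤ ENNReal.ofReal (δ * K) + ENNReal.ofReal δ⁻¹ * P (cylinder I S) := by
    intro I S hS δ hδ
    classical
    let w : ι → Fin 2 → ℝ≥0∞ := fun k i => ENNReal.ofReal (1 / (1 + b k * spin i))
    have e : ν (cylinder I S) =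
        Measure.infinitePi (fun k => if k ∈ I then coin fair else coin (b k)) (cylinder I S) := by
      have : ∀ k, IsProbabilityMeasure (if k ∈ I then coin fair else coin (b k)) := fun k => by
        split_ifs <;> infer_instance
      rw [Measure.infinitePi_cylinder _ hS, Measure.infinitePi_cylinder _ hS]
      congr 2
      funext i
      rw [if_pos i.2]
    have : ∀ k, IsProbabilityMeasure (if k ∈ I then coin fair else coin (b k)) := fun k => by
      split_ifs <;> infer_instance
    have hm : MeasurableSet (cylinder I S) := MeasurableSet.cylinder (α := fun _ => Fin 2) I hS
    have hmw : Measurable fun x : ι → Fin 2 => ∏ k ∈ I, w k (x k) :=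
      Finset.measurable_fun_prod _ fun k _ =>
        (measurable_of_countable (w k)).comp (measurable_pi_apply k)
    rw [e, infinitePi_eq_withDensity b I _ w (fun k hk => by rw [if_pos hk]; exact coin_fair _)
      (fun k hk => if_neg hk), withDensity_apply _ hm]
    calc ∫⁻ x in cylinder I S, ∏ k ∈ I, w k (x k) ∂P
        ≤ ∫⁻ x in cylinder I S, ENNReal.ofReal δ * (∏ k ∈ I, w k (x k)) ^ 2 +
            ENNReal.ofReal δ⁻¹ ∂P := by
          refine lintegral_mono fun x => ?_
          have : ∏ k ∈ I, w k (x k) ≠ ∞ := ENNReal.prod_ne_top fun k _ => ENNReal.ofReal_ne_top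
          lift ∏ k ∈ I, w k (x k) to NNReal using this with r
          rw [← ENNReal.ofReal_coe_nnreal, ← ENNReal.ofReal_pow r.coe_nonneg, ← ENNReal.ofReal_mul hδ.le,
            ← ENNReal.ofReal_add (by positivity) (by positivity)]
          refine ENNReal.ofReal_le_ofReal ?_
          have h1 : δ * δ⁻¹ = 1 := mul_inv_cancel₀ hδ.ne'
          have h2 : 0 ≤ δ * (r - δ⁻¹) ^ 2 := by positivity
          have h3 : δ * ((r : ℝ) - δ⁻¹) ^ 2 = δ * r ^ 2 - 2 * r * (δ * δ⁻¹) + δ * δ⁻¹ * δ⁻¹ := by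
            ring
          rw [h3, h1] at h2
          linarith [r.coe_nonneg]
      _ = ENNReal.ofReal δ * ∫⁻ x in cylinder I S, (∏ k ∈ I, w k (x k)) ^ 2 ∂P +
            ENNReal.ofReal δ⁻¹ * P (cylinder I S) := by
          rw [lintegral_add_right _ measurable_const, lintegral_const_mul _ (hmw.pow_const 2),
            setLIntegral_const]
      _ ≤ ENNReal.ofReal δ * ENNReal.ofReal K + ENNReal.ofReal δ⁻¹ * P (cylinder I S) := by
          gcongr
          calc _ ≤ ∫⁻ x, ∏ k ∈ I, w k (x k) ^ 2 ∂P := by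
                simp_rw [Finset.prod_pow]
                exact setLIntegral_le_lintegral _ _
            _ = ∏ k ∈ I, ENNReal.ofReal (1 + (b k : ℝ) ^ 2 / (1 - (b k : ℝ) ^ 2)) := by
                rw [lintegral_prod_infinitePi_coin b I fun k i => w k i ^ 2]
                exact Finset.prod_congr rfl fun k _ => lintegral_coin_density_sq _
            _ ≤ _ := by
                rw [← ENNReal.ofReal_prod_of_nonneg fun k _ =>
                  add_nonneg zero_le_one (div_nonneg (sq_nonneg _) (by linarith [hb1 k]))]
                exact ENNReal.ofReal_le_ofReal (hK I)
      _ = _ := by rw [ENNReal.ofReal_mul hδ.le]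
  have hK0 : 0 ≤ K := le_trans (by simp) (hK ∅)
  refine Measure.AbsolutelyContinuous.mk fun B hB hPB => ?_
  have hle : ∀ δ : ℝ, 0 < δ → ν B ≤ ENNReal.ofReal (δ * K + δ + δ ^ 2) := by
    intro δ hδ
    -- Approximation in `P + ν` controls both measures at once; the accuracy `δ ^ 2` absorbs the
    -- factor `δ⁻¹` in `key`.
    obtain ⟨I, S, hS, h⟩ := exists_cylinder_symmDiff_lt (P + ν) hB
      (ε := ENNReal.ofReal (δ ^ 2)) (by positivity)
    rw [Measure.add_apply] at h
    have hP : P (cylinder I S) ≤ ENNReal.ofReal (δ ^ 2) := by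
      calc P (cylinder I S) ≤ P (symmDiff (cylinder I S) B ∪ B) := by
            refine measure_mono fun x hx => ?_
            by_cases hxB : x ∈ B
            · exact Or.inr hxB
            · exact Or.inl (Or.inl ⟨hx, hxB⟩)
        _ ≤ P (symmDiff (cylinder I S) B) + P B := measure_union_le _ _
        _ ≤ _ := by rw [hPB, add_zero]; exact le_self_add.trans h.le
    calc ν B ≤ ν (symmDiff (cylinder I S) B ∪ cylinder I S) := by
          refine measure_mono fun x hx => ?_
          by_cases hxC : x ∈ cylinder I S
          · exact Or.inr hxC
          · exact Or.inl (Or.inr ⟨hx, hxC⟩)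
      _ ≤ ν (symmDiff (cylinder I S) B) + ν (cylinder I S) := measure_union_le _ _
      _ ≤ ENNReal.ofReal (δ ^ 2) +
          (ENNReal.ofReal (δ * K) + ENNReal.ofReal δ⁻¹ * ENNReal.ofReal (δ ^ 2)) := by
          gcongr
          · exact le_add_self.trans h.le
          · exact (key I S hS δ hδ).trans (by gcongr)
      _ = _ := by
          rw [← ENNReal.ofReal_mul (by positivity), ← ENNReal.ofReal_add (by positivity)
            (by positivity), ← ENNReal.ofReal_add (by positivity) (by positivity)]
          congr 1
          field_simp
          ring
  have ht : Tendsto (fun δ : ℝ => ENNReal.ofReal (δ * K + δ + δ ^ 2)) (𝓝[>] 0) (𝓝 0) := by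
    have : Continuous fun δ : ℝ => ENNReal.ofReal (δ * K + δ + δ ^ 2) :=
      ENNReal.continuous_ofReal.comp (by fun_prop)
    simpa using (this.tendsto 0).mono_left nhdsWithin_le_nhds
  exact le_antisymm (ge_of_tendsto ht (eventually_mem_nhdsWithin.mono fun δ hδ => hle δ hδ)) bot_le

end Kakutani

/-! ### What the shift hypotheses say about the biases -/

/-- Late terms of size at most `η` are below `η / 2`, by convergence of the truncated series. A jump
smaller than `η / 2` cannot leave `[-η, η]` from there, so once the sequence is below `η / 2` it is
trapped and the truncation is eventually void. -/
theorem summable_of_tendsto_of_summable_truncated {q : ℕ → ℝ}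
    (hd : ∀ δ > 0, ∀ᶠ n in atTop, |q (n + 1) - q n| < δ) (hf : ∀ ε > 0, ∃ᶠ n in atTop, |q n| < ε)
    {η : ℝ} (hη : 0 < η) (hs : Summable fun n => if |q n| ≤ η then q n ^ 2 else 0) :
    Summable fun n => q n ^ 2 := by
  have h1 := (hs.tendsto_atTop_zero.eventually (gt_mem_nhds (show 0 < (η / 2) ^ 2 by positivity)))
  obtain ⟨N, hN⟩ := eventually_atTop.1 (h1.and (hd (η / 2) (by positivity)))
  obtain ⟨M, hM, hqM⟩ := frequently_atTop.1 (hf (η / 2) (by positivity)) N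
  have h2 : ∀ n ≥ M, |q n| < η / 2 := by
    intro n hn
    induction n, hn using Nat.le_induction with
    | base => exact hqM
    | succ n hn ih =>
      have h3 := (hN n (hM.trans hn)).2
      have h4 : |q (n + 1)| ≤ η := by
        have := abs_add_le (q (n + 1) - q n) (q n)
        rw [sub_add_cancel] at this
        linarith
      have h5 := (hN (n + 1) (by omega)).1
      rw [if_pos h4, sq_lt_sq, abs_of_pos (half_pos hη)] at h5
      exact h5
  refine hs.congr_cofinite ?_
  rw [Nat.cofinite_eq_atTop]
  filter_upwards [eventually_ge_atTop M] with n hn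
  rw [if_pos ((h2 n hn).le.trans (by linarith))]

theorem tsum_ofReal_exp_neg_mul_ne_top {c : ℝ} (hc : 0 < c) :
    ∑' n : ℕ, ENNReal.ofReal (Real.exp (-(c * n))) ≠ ∞ := by
  have h : Summable fun n : ℕ => Real.exp (-(c * n)) := by
    have := Real.summable_exp_nat_mul_iff.2 (neg_lt_zero.2 hc)
    refine this.congr fun n => ?_
    congr 1
    ring
  rw [← ENNReal.ofReal_tsum_of_nonneg (fun n => (Real.exp_pos _).le) h]
  exact ENNReal.ofReal_ne_top

/-- Almost surely, all but finitely many of the spin sums over finite sets `F n` of size `n` stay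
below the mean plus a fixed multiple of `n`. -/
theorem ae_eventually_sum_spin_lt {ι : Type*} (b : ι → Ioo (-1 : ℝ) 1) (F : ℕ → Finset ι)
    (hF : ∀ n, (F n).card = n) {c : ℝ} (hc : |c| = 1) {δ : ℝ} (hδ : 0 < δ) :
    ∀ᵐ x ∂Measure.infinitePi (fun k => coin (b k)), ∀ᶠ n : ℕ in atTop,
      c * ∑ k ∈ F n, spin (x k) < c * ∑ k ∈ F n, (b k : ℝ) + δ * n := by
  have h := ae_eventually_notMem (μ := Measure.infinitePi fun k => coin (b k))
    (s := fun n : ℕ => {x : ι → Fin 2 |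
      c * ∑ k ∈ F n, (b k : ℝ) + δ * n ≤ c * ∑ k ∈ F n, spin (x k)}) ?_
  · filter_upwards [h] with x hx
    filter_upwards [hx] with n hn
    exact not_le.1 hn
  -- Borel–Cantelli: Hoeffding with `r = δ n` and `n` spins gives the summable bound `exp (-δ ^ 2 n
  -- / 2)`.
  · refine ne_top_of_le_ne_top (tsum_ofReal_exp_neg_mul_ne_top (c := δ ^ 2 / 2) (by positivity))
      (ENNReal.tsum_le_tsum fun n => ?_)
    rw [← ofReal_measureReal]
    refine ENNReal.ofReal_le_ofReal
      ((measure_sum_spin_ge_le b (F n) hc (r := δ * n) (by positivity)).trans ?_)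
    rw [hF]
    refine Real.exp_le_exp.2 (le_of_eq ?_)
    rcases eq_or_ne (n : ℝ) 0 with h0 | h0
    · simp [h0]
    · field_simp

section Shift

variable (a : ℕ+ → Ioo (-1 : ℝ) 1)

theorem twoSided_natCast_add_one (n : ℕ) : twoSided a (n + 1) = a n.succPNat := by
  rw [twoSided, dif_pos (by omega)]
  congr 1

theorem twoSided_of_nonpos {k : ℤ} (hk : k ≤ 0) : twoSided a k = fair := by
  rw [twoSided, dif_neg (by omega)]
  rfl

theorem map_fullShift :
    (halfStationaryMeasure a).map fullShift =
      Measure.infinitePi fun k => coin (twoSided a (k + 1)) :=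
  Measure.map_infinitePi_infinitePi_of_inj (P := fun k => coin (twoSided a k))
    (add_left_injective (1 : ℤ))

theorem fullShift_iterate (n : ℕ) (x : ℤ → Fin 2) (k : ℤ) :
    fullShift^[n] x k = x (k + n) := by
  induction n generalizing x with
  | zero => simp
  | succ n ih =>
    rw [Function.iterate_succ_apply, ih]
    change x (k + n + 1) = _
    congr 1
    push_cast
    ring

variable {a}

/-- If the shift is nonsingular then consecutive biases get close to each other. -/
theorem eventually_abs_sub_lt_of_isNonsingular (h : IsNonsingular fullShift (halfStationaryMeasure a)) {δ : ℝ}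
    (hδ : 0 < δ) : ∀ᶠ n : ℕ in atTop, |(a (n + 1).succPNat : ℝ) - a n.succPNat| < δ := by
  by_contra hcon
  obtain ⟨c, hc, hf⟩ : ∃ c : ℝ, |c| = 1 ∧
      ∃ᶠ n : ℕ in atTop, δ ≤ c * ((a (n + 1).succPNat : ℝ) - a n.succPNat) := by
    have h1 : ∃ᶠ n : ℕ in atTop, δ ≤ 1 * ((a (n + 1).succPNat : ℝ) - a n.succPNat) ∨
        δ ≤ -1 * ((a (n + 1).succPNat : ℝ) - a n.succPNat) := by
      refine (not_eventually.1 hcon).mono fun n hn => ?_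
      rw [one_mul, neg_one_mul]
      exact le_abs.1 (not_lt.1 hn)
    rcases frequently_or_distrib.1 h1 with h | h
    · exact ⟨1, by simp, h⟩
    · exact ⟨-1, by simp, h⟩
  have hinf := Nat.frequently_atTop_iff_infinite.1 hf
  choose G hG hGc using fun n : ℕ => hinf.exists_subset_card_eq n
  let F : ℕ → Finset ℤ := fun n =>
    (G n).map ⟨fun k : ℕ => (k : ℤ) + 1, fun i j h => by simpa using h⟩
  have hF : ∀ n, (F n).card = n := fun n => by rw [Finset.card_map, hGc]
  -- Nonsingularity transfers this `P`-almost sure bound to `T_* P`. There the mean of `c * ∑ spin`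
  -- is larger by at least `n * δ`, so the lower bound for `T_* P`, with margin `δ / 2` on each
  -- side, contradicts it.
  have h1 := (ae_eventually_sum_spin_lt (twoSided a) F hF hc (half_pos hδ)).filter_mono h.1.ae_le
  rw [map_fullShift] at h1
  have h2 := ae_eventually_sum_spin_lt (fun k => twoSided a (k + 1)) F hF (c := -c)
    (by rwa [abs_neg]) (half_pos hδ)
  obtain ⟨x, hx1, hx2⟩ := (h1.and h2).exists
  obtain ⟨n, hn1, hn2⟩ := (hx1.and hx2).exists
  have h3 : (n : ℝ) * δ ≤
      c * ∑ k ∈ F n, (twoSided a (k + 1) : ℝ) - c * ∑ k ∈ F n, (twoSided a k : ℝ) := by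
    rw [← mul_sub, ← Finset.sum_sub_distrib, Finset.mul_sum, Finset.sum_map, ← nsmul_eq_mul]
    nth_rw 1 [← hGc n]
    refine Finset.card_nsmul_le_sum _ _ _ fun k hk => ?_
    have h4 : (k : ℤ) + 1 + 1 = ((k + 1 : ℕ) : ℤ) + 1 := by push_cast; rfl
    change δ ≤ c * ((twoSided a ((k : ℤ) + 1 + 1) : ℝ) - twoSided a ((k : ℤ) + 1))
    rw [h4, twoSided_natCast_add_one, twoSided_natCast_add_one]
    exact hG n hk
  linarith

/-- If the shift is conservative and consecutive biases get close to each other, then the biases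
get close to zero infinitely often. -/
theorem frequently_abs_lt_of_conservative (h : Conservative fullShift (halfStationaryMeasure a))
    (hd : ∀ δ > 0, ∀ᶠ n : ℕ in atTop, |(a (n + 1).succPNat : ℝ) - a n.succPNat| < δ) {ε : ℝ}
    (hε : 0 < ε) : ∃ᶠ n : ℕ in atTop, |(a n.succPNat : ℝ)| < ε := by
  by_contra hcon
  simp only [not_frequently, not_lt] at hcon
  obtain ⟨N, hN⟩ := eventually_atTop.1 (hcon.and (hd ε hε))
  -- From `N` on the biases have absolute value at least `ε` and jumps below `ε`, so they cannot
  -- change sign.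
  obtain ⟨c, hc, hcN⟩ : ∃ c : ℝ, |c| = 1 ∧ ∀ n ≥ N, ε ≤ c * a n.succPNat := by
    obtain ⟨c, hc, hc'⟩ : ∃ c : ℝ, |c| = 1 ∧ ε ≤ c * a N.succPNat := by
      rcases le_abs.1 (hN N le_rfl).1 with h | h
      · exact ⟨1, by simp, by simpa using h⟩
      · exact ⟨-1, by simp, by simpa using h⟩
    refine ⟨c, hc, fun n hn => ?_⟩
    induction n, hn using Nat.le_induction with
    | base => exact hc'
    | succ n hn ih =>
      have h1 := (hN n hn).2
      have h2 := (hN (n + 1) (by omega)).1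
      have h3 : |c * ((a (n + 1).succPNat : ℝ) - a n.succPNat)| < ε := by rwa [abs_mul, hc, one_mul]
      have h4 : ε ≤ |c * (a (n + 1).succPNat : ℝ)| := by rwa [abs_mul, hc, one_mul]
      rw [abs_lt, mul_sub] at h3
      rcases le_abs.1 h4 with h5 | h5 <;> linarith
  let F : ℕ → Finset ℤ := fun n =>
    (Finset.range n).map ⟨fun k : ℕ => (k : ℤ) + 1, fun i j h => by simpa using h⟩
  let F' : ℕ → Finset ℤ := fun n =>
    (Finset.range n).map ⟨fun k : ℕ => (k : ℤ) + 1 - n, fun i j h => by simpa using h⟩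
  have h1 := ae_eventually_sum_spin_lt (twoSided a) F' (fun n => by simp [F']) hc
    (half_pos hε)
  have h2 := ae_eventually_sum_spin_lt (twoSided a) F (fun n => by simp [F]) (c := -c)
    (by rwa [abs_neg]) (show 0 < ε / 4 by positivity)
  have h3 : ∀ n, ∑ k ∈ F' n, (twoSided a k : ℝ) = 0 := by
    intro n
    rw [Finset.sum_map]
    refine Finset.sum_eq_zero fun k hk => ?_
    rw [Finset.mem_range] at hk
    rw [twoSided_of_nonpos]
    · rfl
    · change (k : ℤ) + 1 - n ≤ 0
      omega
  have h4 : ∀ n : ℕ, ε * n - (1 + ε) * N ≤ c * ∑ k ∈ F n, (twoSided a k : ℝ) := by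
    intro n
    -- The first `N` biases are uncontrolled but at least `-1` after multiplication by `c`; each
    -- costs `1 + ε`.
    have h5 : ∑ k ∈ Finset.range n, (ε - if k < N then 1 + ε else 0) ≤
        c * ∑ k ∈ F n, (twoSided a k : ℝ) := by
      rw [Finset.mul_sum, Finset.sum_map]
      refine Finset.sum_le_sum fun k _ => ?_
      change _ ≤ c * (twoSided a ((k : ℤ) + 1) : ℝ)
      rw [twoSided_natCast_add_one]
      split_ifs with hk
      · have h6 : |c * (a k.succPNat : ℝ)| ≤ 1 := by
          rw [abs_mul, hc, one_mul, abs_le]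
          exact ⟨(a k.succPNat).2.1.le, (a k.succPNat).2.2.le⟩
        linarith [(abs_le.1 h6).1]
      · linarith [hcN k (not_lt.1 hk)]
    refine le_trans ?_ h5
    rw [Finset.sum_sub_distrib, Finset.sum_const, Finset.card_range, nsmul_eq_mul,
      ← Finset.sum_filter, Finset.sum_const, nsmul_eq_mul]
    have h6 : (((Finset.range n).filter (· < N)).card : ℝ) ≤ N := by
      rw [Nat.cast_le]
      refine (Finset.card_le_card fun k hk => ?_).trans (Finset.card_range N).le
      exact Finset.mem_range.2 (Finset.mem_filter.1 hk).2
    nlinarith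
  -- Points whose averages over the fair windows `{1 - n, …, 0}` stay small from `M` on. A return at
  -- time `n` would require the same of the biased window `{1, …, n}`, where the sum eventually
  -- exceeds `ε / 2 * n`.
  let A : ℕ → Set (ℤ → Fin 2) := fun M =>
    {x | ∀ n ≥ M, c * ∑ k ∈ F' n, spin (x k) < ε / 2 * n}
  have hA : ∀ M, MeasurableSet (A M) := fun M => by
    simp only [A, ofPred_forall]
    refine MeasurableSet.iInter fun n => MeasurableSet.iInter fun _ =>
      measurableSet_lt (Measurable.const_mul (Finset.measurable_fun_sum _ fun k _ => ?_) _)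
        measurable_const
    fun_prop
  obtain ⟨M, hM⟩ : ∃ M, halfStationaryMeasure a (A M) ≠ 0 := by
    by_contra! hcon
    have h5 : ∀ᵐ x ∂halfStationaryMeasure a, ∀ M, x ∉ A M :=
      ae_all_iff.2 fun M => measure_eq_zero_iff_ae_notMem.1 (hcon M)
    have : (ae (halfStationaryMeasure a)).NeBot := by
      unfold halfStationaryMeasure
      infer_instance
    obtain ⟨x, hx, hx'⟩ := (h5.and h1).exists
    obtain ⟨M, hM⟩ := eventually_atTop.1 hx'
    refine hx M fun n hn => ?_
    have := hM n hn
    rwa [h3, mul_zero, zero_add] at this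
  refine hM (measure_eq_zero_iff_ae_notMem.2 ?_)
  have hret := h.ae_mem_imp_frequently_image_mem (hA M).nullMeasurableSet
  filter_upwards [hret, h2] with x hx hx2 hxA
  have hbig : ∀ᶠ n : ℕ in atTop, (1 + ε) * N < ε / 4 * n :=
    (tendsto_natCast_atTop_atTop.const_mul_atTop (by positivity)).eventually_gt_atTop _
  obtain ⟨n, hn, hn2, hn3, hn4⟩ :=
    ((hx hxA).and_eventually (hx2.and (hbig.and (eventually_ge_atTop M)))).exists
  have h5 := hn n hn4
  have h6 : ∑ k ∈ F' n, spin (fullShift^[n] x k) = ∑ k ∈ F n, spin (x k) := by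
    simp only [F, F', Finset.sum_map, fullShift_iterate]
    refine Finset.sum_congr rfl fun k _ => ?_
    change spin (x ((k : ℤ) + 1 - n + n)) = spin (x ((k : ℤ) + 1))
    rw [sub_add_cancel]
  rw [h6] at h5
  have := h4 n
  linarith

/-- Without an absolutely continuous invariant probability the biases are not square summable. -/
theorem not_summable_sq (h : ¬ HasACIP fullShift (halfStationaryMeasure a)) :
    ¬ Summable fun n : ℕ => (a n.succPNat : ℝ) ^ 2 := by
  intro hs
  refine h ⟨Measure.infinitePi fun _ => coin fair, inferInstance, fair_absolutelyContinuous _ ?_,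
    fullShift.measurable, ?_⟩
  · have hi : Function.Injective fun n : ℕ => (n : ℤ) + 1 := fun i j h => by simpa using h
    rw [← hi.summable_iff]
    · refine hs.congr fun n => ?_
      rw [Function.comp_apply, twoSided_natCast_add_one]
    · intro k hk
      rw [twoSided_of_nonpos]
      · simp [fair]
      · by_contra hk'
        exact hk ⟨(k - 1).toNat, by simp only; omega⟩
  · exact Measure.map_infinitePi_infinitePi_of_inj (P := fun _ => coin fair)
      (add_left_injective (1 : ℤ))

end Shift

/-! ### Orbits of the odometer as binary addition -/

section Orbits

theorem odometer_apply (x : ℕ+ → Fin 2) : odometer x = carryMap 1 x := rfl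

/-- The number with binary digits `x_1, …, x_M`, least significant digit first. -/
def binaryValue (M : ℕ) (x : ℕ+ → Fin 2) : ℕ :=
  ∑ i ∈ Finset.range M, (x i.succPNat : ℕ) * 2 ^ i

theorem binaryValue_succ (M : ℕ) (x : ℕ+ → Fin 2) :
    binaryValue (M + 1) x = binaryValue M x + (x M.succPNat : ℕ) * 2 ^ M :=
  Finset.sum_range_succ _ _

theorem binaryValue_lt (M : ℕ) (x : ℕ+ → Fin 2) : binaryValue M x < 2 ^ M := by
  induction M with
  | zero => simp [binaryValue]
  | succ M ih =>
    rw [binaryValue_succ, pow_succ]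
    have : (x M.succPNat : ℕ) ≤ 1 := by omega
    nlinarith [Nat.pos_of_ne_zero (pow_ne_zero M (two_ne_zero (α := ℕ)))]

theorem eq_of_binaryValue_eq {M : ℕ} {x y : ℕ+ → Fin 2} (h : binaryValue M x = binaryValue M y)
    {i : ℕ} (hi : i < M) : x i.succPNat = y i.succPNat := by
  induction M with
  | zero => omega
  | succ M ih =>
    rw [binaryValue_succ, binaryValue_succ] at h
    have h1 := binaryValue_lt M x
    have h2 := binaryValue_lt M y
    have h3 : (x M.succPNat : ℕ) ≤ 1 := by omega
    have h4 : (y M.succPNat : ℕ) ≤ 1 := by omega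
    have h5 : x M.succPNat = y M.succPNat := by
      apply Fin.ext
      rcases Nat.le_one_iff_eq_zero_or_eq_one.1 h3 with h3 | h3 <;>
        rcases Nat.le_one_iff_eq_zero_or_eq_one.1 h4 with h4 | h4 <;> rw [h3, h4] at h ⊢ <;> omega
    rw [h5] at h
    rcases Nat.lt_succ_iff_lt_or_eq.1 hi with hi | rfl
    · exact ih (by omega) hi
    · exact h5

theorem forall_lt_succPNat {M : ℕ} {p : ℕ+ → Prop} :
    (∀ m < M.succPNat, p m) ↔ ∀ i < M, p i.succPNat := by
  constructor
  · intro h i hi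
    exact h _ (Nat.succPNat_lt_succPNat.2 hi)
  · intro h m hm
    obtain ⟨i, rfl⟩ : ∃ i : ℕ, i.succPNat = m := ⟨m.natPred, PNat.succPNat_natPred m⟩
    exact h i (Nat.succPNat_lt_succPNat.1 hm)

-- Addition of one modulo `2 ^ M`: the carry leaves the first `M` digits exactly when they are all
-- `1`.
open Classical in
theorem binaryValue_odometer (M : ℕ) (x : ℕ+ → Fin 2) :
    binaryValue M (odometer x) + (if ∀ i < M, x i.succPNat = 1 then 2 ^ M else 0) =
      binaryValue M x + 1 := by
  induction M with
  | zero => simp [binaryValue]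
  | succ M ih =>
    have h1 : (∀ i < M + 1, x i.succPNat = 1) ↔
        (∀ i < M, x i.succPNat = 1) ∧ x M.succPNat = 1 := Nat.forall_lt_succ_right
    have h2 : odometer x M.succPNat =
        if ∀ i < M, x i.succPNat = 1 then 1 - x M.succPNat else x M.succPNat := by
      rw [odometer_apply, carryMap]
      exact if_congr forall_lt_succPNat rfl rfl
    rw [binaryValue_succ, binaryValue_succ, h2, pow_succ]
    by_cases h : ∀ i < M, x i.succPNat = 1
    · rw [if_pos h] at ih
      by_cases h3 : x M.succPNat = 1
      · rw [if_pos h, if_pos (h1.2 ⟨h, h3⟩), h3]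
        simp
        omega
      · have h4 : x M.succPNat = 0 := by omega
        rw [if_pos h, if_neg fun h5 => h3 (h1.1 h5).2, h4]
        simp
        omega
    · rw [if_neg h] at ih
      rw [if_neg h, if_neg fun h5 => h (h1.1 h5).1]
      omega

theorem not_forall_of_binaryValue {M : ℕ} {x : ℕ+ → Fin 2} (h : binaryValue M x + 1 < 2 ^ M) :
    ¬ ∀ i < M, x i.succPNat = 1 := by
  intro h1
  have h2 := binaryValue_odometer M x
  rw [if_pos h1] at h2
  omega

theorem odometer_apply_of_not_forall {M : ℕ} {x : ℕ+ → Fin 2} (h : ¬ ∀ i < M, x i.succPNat = 1)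
    {i : ℕ} (hi : M ≤ i) : odometer x i.succPNat = x i.succPNat := by
  rw [odometer_apply, carryMap, if_neg]
  rw [forall_lt_succPNat]
  exact fun h1 => h fun j hj => h1 j (by omega)

theorem odometer_iterate_of_binaryValue {M : ℕ} (n : ℕ) {x : ℕ+ → Fin 2}
    (h : binaryValue M x + n < 2 ^ M) :
    binaryValue M (odometer^[n] x) = binaryValue M x + n ∧
      ∀ i ≥ M, odometer^[n] x i.succPNat = x i.succPNat := by
  induction n with
  | zero => simp
  | succ n ih =>
    obtain ⟨h1, h2⟩ := ih (by omega)
    have h3 := not_forall_of_binaryValue (M := M) (x := odometer^[n] x) (by omega)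
    have h4 := binaryValue_odometer M (odometer^[n] x)
    rw [if_neg h3] at h4
    rw [Function.iterate_succ_apply']
    refine ⟨by omega, fun i hi => ?_⟩
    rw [odometer_apply_of_not_forall h3 hi, h2 i hi]

/-- Tail-equivalent points lie on one orbit: counting up from the smaller prefix to the larger never
carries past digit `M`. -/
theorem odometer_iterate_eq {M : ℕ} {x y : ℕ+ → Fin 2}
    (hxy : ∀ i ≥ M, x i.succPNat = y i.succPNat) (h : binaryValue M x ≤ binaryValue M y) :
    odometer^[binaryValue M y - binaryValue M x] x = y := by
  have h1 := binaryValue_lt M y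
  obtain ⟨h2, h3⟩ := odometer_iterate_of_binaryValue (M := M) (x := x)
    (binaryValue M y - binaryValue M x) (by omega)
  funext k
  obtain ⟨i, rfl⟩ : ∃ i : ℕ, i.succPNat = k := ⟨k.natPred, PNat.succPNat_natPred k⟩
  rcases lt_or_ge i M with hi | hi
  · exact eq_of_binaryValue_eq (h2.trans (by omega)) hi
  · rw [h3 i hi, hxy i hi]

theorem carryMap_eq_flipOn {c : Fin 2} {x : ℕ+ → Fin 2} {m : ℕ+} (h : ∀ i < m, x i = c)
    (hm : x m ≠ c) : carryMap c x = flipOn (Finset.Iic m) x := by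
  funext k
  rw [carryMap, flipOn]
  congr 1
  rw [Finset.mem_Iic, eq_iff_iff]
  constructor
  · intro h1
    by_contra hk
    exact hm (h1 m (not_le.1 hk))
  · intro hk i hi
    exact h i (hi.trans_le hk)

theorem exists_carryMap_eq_flipOn {c : Fin 2} {x : ℕ+ → Fin 2} (h : ¬ ∀ i, x i = c) :
    ∃ m : ℕ+, (∀ i < m, x i = c) ∧ x m ≠ c := by
  classical
  push Not at h
  exact ⟨PNat.find h, fun i hi => not_not.1 (PNat.find_min h hi), PNat.find_spec h⟩

end Orbits

/-! ### Nonsingularity and ergodicity of the odometer -/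

section Measure

variable {a : ℕ+ → Ioo (-1 : ℝ) 1}

instance : IsProbabilityMeasure (oneSidedMeasure a) := by
  unfold oneSidedMeasure
  infer_instance

theorem oneSidedMeasure_const_eq_zero (h : ∃ᶠ n : ℕ in atTop, |(a n.succPNat : ℝ)| < 1 / 2)
    (c : Fin 2) : oneSidedMeasure a {x | ∀ i, x i = c} = 0 := by
  have hinf := Nat.frequently_atTop_iff_infinite.1 h
  refine le_antisymm (ge_of_tendsto' (ENNReal.tendsto_pow_atTop_nhds_zero_of_lt_one
    (r := ENNReal.ofReal (3 / 4)) (by norm_num)) fun n => ?_) bot_le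
  obtain ⟨G, hG, hGc⟩ := hinf.exists_subset_card_eq n
  calc oneSidedMeasure a {x | ∀ i, x i = c}
      ≤ oneSidedMeasure a (Set.pi (G.map ⟨Nat.succPNat, Nat.succPNat_injective⟩ : Finset ℕ+)
          fun _ => {c}) := measure_mono fun x hx i _ => hx i
    _ = ∏ i ∈ G, coin (a i.succPNat) {c} := by
        rw [oneSidedMeasure, Measure.infinitePi_pi _ fun _ _ => measurableSet_singleton _,
          Finset.prod_map]
        rfl
    _ ≤ ∏ i ∈ G, ENNReal.ofReal (3 / 4) := by
        refine Finset.prod_le_prod' fun i hi => ?_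
        rw [coin_singleton]
        refine ENNReal.ofReal_le_ofReal ?_
        have h1 : |(a i.succPNat : ℝ) * spin c| < 1 / 2 := by
          rw [abs_mul, abs_spin, mul_one]
          exact hG hi
        linarith [(abs_lt.1 h1).2]
    _ = _ := by rw [Finset.prod_const, hGc]

/-- Off a constant sequence, which is null, the carry map agrees pointwise with one of countably
many finite flips, and these preserve null sets. -/
theorem measure_carryMap_preimage_eq_zero
    (h : ∃ᶠ n : ℕ in atTop, |(a n.succPNat : ℝ)| < 1 / 2) (c : Fin 2) {B : Set (ℕ+ → Fin 2)}
    (hB : MeasurableSet B) (h0 : oneSidedMeasure a B = 0) :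
    oneSidedMeasure a (carryMap c ⁻¹' B) = 0 := by
  refine measure_mono_null (t := {x | ∀ i, x i = c} ∪ ⋃ m, flipOn (Finset.Iic m) ⁻¹' B) ?_ ?_
  · intro x hx
    by_cases hc : ∀ i, x i = c
    · exact Or.inl hc
    · obtain ⟨m, hm, hm'⟩ := exists_carryMap_eq_flipOn hc
      rw [mem_preimage, carryMap_eq_flipOn hm hm'] at hx
      exact Or.inr (mem_iUnion.2 ⟨m, hx⟩)
  · exact measure_union_null (oneSidedMeasure_const_eq_zero h c)
      (measure_iUnion_null fun m => measure_flipOn_preimage_eq_zero a _ hB h0)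

theorem odometer_quasiMeasurePreserving (h : ∃ᶠ n : ℕ in atTop, |(a n.succPNat : ℝ)| < 1 / 2) :
    Measure.QuasiMeasurePreserving odometer (oneSidedMeasure a) (oneSidedMeasure a) where
  measurable := odometer.measurable
  absolutelyContinuous := Measure.AbsolutelyContinuous.mk fun B hB h0 => by
    rw [Measure.map_apply odometer.measurable hB]
    exact measure_carryMap_preimage_eq_zero h 1 hB h0

theorem odometer_isNonsingular (h : ∃ᶠ n : ℕ in atTop, |(a n.succPNat : ℝ)| < 1 / 2) :
    IsNonsingular odometer (oneSidedMeasure a) := by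
  refine ⟨(odometer_quasiMeasurePreserving h).absolutelyContinuous,
    Measure.AbsolutelyContinuous.mk fun B hB h0 => ?_⟩
  rw [odometer.map_apply] at h0
  have := measure_carryMap_preimage_eq_zero h 0 (odometer.measurable hB) h0
  change oneSidedMeasure a (odometer.symm ⁻¹' (odometer ⁻¹' B)) = 0 at this
  rwa [← preimage_comp, odometer.self_comp_symm, preimage_id] at this

/-- A set invariant under the odometer is invariant under changes of finitely many coordinates. -/
theorem mem_of_odometer_preimage_eq {s : Set (ℕ+ → Fin 2)} (hs : odometer ⁻¹' s = s) {M : ℕ}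
    {x y : ℕ+ → Fin 2} (hxy : ∀ i ≥ M, x i.succPNat = y i.succPNat) : x ∈ s ↔ y ∈ s := by
  have h1 : ∀ n : ℕ, ∀ z, odometer^[n] z ∈ s ↔ z ∈ s := fun n z => by
    have : odometer^[n] ⁻¹' s = s := by
      rw [Set.preimage_iterate_eq]
      exact Function.iterate_fixed hs n
    rw [← mem_preimage, this]
  rcases le_total (binaryValue M x) (binaryValue M y) with h | h
  · rw [← odometer_iterate_eq hxy h, h1]
  · rw [← odometer_iterate_eq (fun i hi => (hxy i hi).symm) h, h1]

theorem odometer_quasiErgodic (h : ∃ᶠ n : ℕ in atTop, |(a n.succPNat : ℝ)| < 1 / 2) :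
    QuasiErgodic odometer (oneSidedMeasure a) := by
  refine { odometer_quasiMeasurePreserving h with aeconst_set := fun s hs hinv => ?_ }
  have hI : iIndep (fun k : ℕ+ => MeasurableSpace.comap (fun x : ℕ+ → Fin 2 => x k) inferInstance)
      (oneSidedMeasure a) :=
    iIndepFun_infinitePi (P := fun k => coin (a k)) (X := fun _ i => i) fun i => measurable_id
  have h01 := measure_zero_or_one_of_measurableSet_limsup_atTop
    (fun k => (measurable_pi_apply k).comap_le) hI (t := s) ?_
  · rw [Filter.eventuallyConst_set]
    rcases h01 with h0 | h1
    · right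
      exact measure_eq_zero_iff_ae_notMem.1 h0
    · left
      exact (prob_compl_eq_zero_iff hs).2 h1
  · rw [atTop_basis.limsup_eq_iInf_iSup]
    simp only [MeasurableSpace.measurableSet_iInf]
    intro m _
    -- Erasing the coordinates below `m` does not affect membership in `s`, so `s` is a tail event
    -- and Kolmogorov's zero–one law applies.
    let g : (ℕ+ → Fin 2) → ℕ+ → Fin 2 := fun x k => if m ≤ k then x k else 0
    have hg : Measurable[⨆ k ≥ m, MeasurableSpace.comap (fun x : ℕ+ → Fin 2 => x k) inferInstance]
        g := by
      refine @measurable_pi_lambda _ _ _ (_) _ _ fun k => ?_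
      by_cases hk : m ≤ k
      · simp only [g, hk, if_true]
        exact Measurable.mono (comap_measurable _) (le_iSup₂_of_le k hk le_rfl) le_rfl
      · simp only [g, hk, if_false]
        exact measurable_const
    have hgs : g ⁻¹' s = s := by
      ext x
      refine mem_of_odometer_preimage_eq hinv (M := m) fun i hi => if_pos ?_
      rw [← PNat.coe_le_coe, Nat.succPNat_coe]
      omega
    rw [← hgs]
    exact hg hs

end Measure

/-! ### The Radon–Nikodym cocycle as a change of energy -/

theorem energy_flipOn_of_superset {ι : Type*} [DecidableEq ι] (b : ι → Ioo (-1 : ℝ) 1)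
    {F G : Finset ι} (h : G ⊆ F) (x : ι → Fin 2) :
    energy b F (flipOn G x) = energy b F x - 2 * energy b G x := by
  have h1 := energy_flipOn_of_subset b (Finset.Subset.refl G) x
  have h2 : ∑ k ∈ F \ G, logOdds (b k) * spin (flipOn G x k) =
      ∑ k ∈ F \ G, logOdds (b k) * spin (x k) :=
    Finset.sum_congr rfl fun k hk => by rw [flipOn, if_neg (Finset.mem_sdiff.1 hk).2]
  have h3 := Finset.sum_sdiff (f := fun k => logOdds (b k) * spin (flipOn G x k)) h
  have h4 := Finset.sum_sdiff (f := fun k => logOdds (b k) * spin (x k)) h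
  unfold energy at *
  linarith

section Cocycle

variable {a : ℕ+ → Ioo (-1 : ℝ) 1}

theorem ae_logRnDeriv_odometer : ∀ᵐ x ∂oneSidedMeasure a, ∀ m : ℕ+, (∀ i < m, x i = 1) →
    x m ≠ 1 → logRnDeriv odometer (oneSidedMeasure a) x = -energy a (Finset.Iic m) x := by
  set μ := oneSidedMeasure a with hμ
  have : IsProbabilityMeasure μ := inferInstanceAs (IsProbabilityMeasure (oneSidedMeasure a))
  refine ae_all_iff.2 fun m => ?_
  set Z : Set (ℕ+ → Fin 2) := {x | (∀ i < m, x i = 1) ∧ x m ≠ 1} with hZdef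
  have hZ : MeasurableSet Z := by
    have : Z = (⋂ i, ⋂ (_ : i < m), {x | x i = 1}) ∩ {x | x m = 1}ᶜ := by
      ext x
      simp [Z]
    rw [this]
    refine (MeasurableSet.iInter fun i => MeasurableSet.iInter fun _ => ?_).inter
      (MeasurableSet.compl ?_) <;>
    exact measurableSet_eq_fun (measurable_pi_apply _) measurable_const
  let w : (ℕ+ → Fin 2) → ℝ≥0∞ := fun x =>
    ENNReal.ofReal (Real.exp (-energy a (Finset.Iic m) x))
  have hw : Measurable w := by fun_prop
  have hτ : ∀ x ∈ Z, odometer x = flipOn (Finset.Iic m) x := fun x hx =>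
    carryMap_eq_flipOn hx.1 hx.2
  -- On `Z` the odometer is the involution flipping `{1, …, m}`, so `μ ∘ τ` has there the density of
  -- the flipped measure.
  have hr : (μ.map odometer.symm).restrict Z = (μ.withDensity w).restrict Z := by
    have hmap : μ.map (flipOn (Finset.Iic m)) = μ.withDensity w := map_flipOn a _
    ext B hB
    rw [Measure.restrict_apply hB, Measure.restrict_apply hB, ← hmap,
      Measure.map_apply odometer.symm.measurable (hB.inter hZ),
      Measure.map_apply (measurable_flipOn _) (hB.inter hZ)]
    congr 1
    ext y
    constructor
    · intro hy
      have h1 := hτ _ hy.2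
      rw [odometer.apply_symm_apply] at h1
      rw [mem_preimage, h1, flipOn_flipOn]
      exact hy
    · intro hy
      have h1 := hτ _ hy.2
      rw [flipOn_flipOn] at h1
      have h2 : odometer.symm y = flipOn (Finset.Iic m) y := by
        conv_lhs => rw [← h1]
        exact odometer.symm_apply_apply _
      rw [mem_preimage, h2]
      exact hy
  have : (μ.map odometer.symm).HaveLebesgueDecomposition μ :=
    Measure.haveLebesgueDecomposition_of_finiteMeasure
  have : (μ.withDensity w).HaveLebesgueDecomposition μ :=
    Measure.haveLebesgueDecomposition_withDensity μ hw
  have h1 := Measure.rnDeriv_restrict (μ.map odometer.symm) μ hZ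
  have h2 := Measure.rnDeriv_restrict (μ.withDensity w) μ hZ
  have h3 := Measure.rnDeriv_withDensity μ hw
  rw [hr] at h1
  filter_upwards [h1, h2, h3] with x h1 h2 h3 hx hx'
  have hxZ : x ∈ Z := ⟨hx, hx'⟩
  rw [h1, indicator_of_mem hxZ, indicator_of_mem hxZ, h3] at h2
  rw [logRnDeriv, rnDerivAlong, h2, ENNReal.toReal_ofReal (Real.exp_pos _).le, Real.log_exp]

/-- Half the energy over the first `M` digits is, up to a constant, the log-mass of that word. As
long as carries stay within these digits the cocycle is its coboundary, so Birkhoff sums telescope.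
-/
theorem logRnDeriv_eq_sub {x : ℕ+ → Fin 2}
    (h : ∀ m : ℕ+, (∀ i < m, x i = 1) →
      x m ≠ 1 → logRnDeriv odometer (oneSidedMeasure a) x = -energy a (Finset.Iic m) x)
    {M : ℕ} (hx : ¬ ∀ i < M, x i.succPNat = 1) {F : Finset ℕ+}
    (hF : ∀ k : ℕ+, k ∈ F ↔ (k : ℕ) ≤ M) :
    logRnDeriv odometer (oneSidedMeasure a) x =
      (energy a F (odometer x) - energy a F x) / 2 := by
  obtain ⟨m, hm, hm'⟩ := exists_carryMap_eq_flipOn (c := 1) (x := x)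
    fun h1 => hx fun i _ => h1 _
  have hmF : Finset.Iic m ⊆ F := by
    intro k hk
    rw [Finset.mem_Iic] at hk
    rw [hF]
    by_contra hkM
    refine hx fun i hi => hm _ (lt_of_lt_of_le ?_ hk)
    rw [← PNat.coe_lt_coe, Nat.succPNat_coe]
    omega
  rw [h m hm hm', odometer_apply, carryMap_eq_flipOn hm hm', energy_flipOn_of_superset a hmF]
  ring

theorem birkhoffSum_logRnDeriv {x : ℕ+ → Fin 2}
    (h : ∀ n : ℕ, ∀ m : ℕ+, (∀ i < m, odometer^[n] x i = 1) → odometer^[n] x m ≠ 1 →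
      logRnDeriv odometer (oneSidedMeasure a) (odometer^[n] x) =
        -energy a (Finset.Iic m) (odometer^[n] x))
    {M n : ℕ} (hn : binaryValue M x + n < 2 ^ M) {F : Finset ℕ+}
    (hF : ∀ k : ℕ+, k ∈ F ↔ (k : ℕ) ≤ M) :
    birkhoffSum odometer (logRnDeriv odometer (oneSidedMeasure a)) n x =
      (energy a F (odometer^[n] x) - energy a F x) / 2 := by
  induction n with
  | zero => simp
  | succ n ih =>
    have h1 := (odometer_iterate_of_binaryValue (M := M) n (x := x) (by omega)).1
    rw [birkhoffSum_succ, ih (by omega), logRnDeriv_eq_sub (h n)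
      (not_forall_of_binaryValue (M := M) (by omega)) hF, Function.iterate_succ_apply']
    ring

/-- Almost surely, flipping finitely many coordinates, the last of which is `0`, is a positive
iterate of the odometer along which the Radon–Nikodym cocycle is the change of energy. -/
theorem ae_exists_odometer_iterate_eq_flipOn
    (h : ∃ᶠ n : ℕ in atTop, |(a n.succPNat : ℝ)| < 1 / 2) :
    ∀ᵐ x ∂oneSidedMeasure a, ∀ (G : Finset ℕ+) (j : ℕ+), j ∈ G → (∀ k ∈ G, k ≤ j) → x j = 0 →
      ∃ n : ℕ, 1 ≤ n ∧ odometer^[n] x = flipOn G x ∧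
        birkhoffSum odometer (logRnDeriv odometer (oneSidedMeasure a)) n x = -energy a G x := by
  have h1 : ∀ᵐ x ∂oneSidedMeasure a, ∀ n : ℕ, ∀ m : ℕ+, (∀ i < m, odometer^[n] x i = 1) →
      odometer^[n] x m ≠ 1 → logRnDeriv odometer (oneSidedMeasure a) (odometer^[n] x) =
        -energy a (Finset.Iic m) (odometer^[n] x) :=
    ae_all_iff.2 fun n => ((odometer_quasiMeasurePreserving h).iterate n).ae ae_logRnDeriv_odometer
  filter_upwards [h1] with x hx G j hjG hG hj
  obtain ⟨p, rfl⟩ : ∃ p : ℕ, p.succPNat = j := ⟨j.natPred, PNat.succPNat_natPred j⟩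
  -- The leading flipped digit goes from `0` to `1` and outweighs all lower digits, so the iterate
  -- is strictly forward.
  have h2 : binaryValue (p + 1) x < binaryValue (p + 1) (flipOn G x) := by
    rw [binaryValue_succ, binaryValue_succ, flipOn, if_pos hjG, hj]
    have := binaryValue_lt p x
    simp
    omega
  have h3 := odometer_iterate_eq (M := p + 1) (x := x) (y := flipOn G x) (fun i hi => by
    rw [flipOn, if_neg]
    intro hiG
    have := hG _ hiG
    rw [Nat.succPNat_le_succPNat] at this
    omega) h2.le
  refine ⟨_, by omega, h3, ?_⟩
  have h4 := binaryValue_lt (p + 1) (flipOn G x)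
  rw [birkhoffSum_logRnDeriv hx (M := p + 1) (by omega) (F := Finset.Iic p.succPNat), h3,
    energy_flipOn_of_superset]
  · ring
  · intro k hk
    exact Finset.mem_Iic.2 (hG k hk)
  · intro k
    rw [Finset.mem_Iic, ← PNat.coe_le_coe, Nat.succPNat_coe]

theorem exists_measure_birkhoffSum_pos (h : ∃ᶠ n : ℕ in atTop, |(a n.succPNat : ℝ)| < 1 / 2)
    {A B : Set (ℕ+ → Fin 2)} (hB : oneSidedMeasure a B ≠ 0) {G : Finset ℕ+} {j : ℕ+}
    (hj : j ∈ G) (hG : ∀ k ∈ G, k ≤ j) {t ε : ℝ}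
    (hBA : ∀ x ∈ B, x ∈ A ∧ flipOn G x ∈ A ∧ x j = 0 ∧ |-energy a G x - t| < ε) :
    ∃ n : ℕ, 1 ≤ n ∧ 0 < oneSidedMeasure a (A ∩ odometer^[n] ⁻¹' A ∩
      {x | |birkhoffSum odometer (logRnDeriv odometer (oneSidedMeasure a)) n x - t| < ε}) := by
  by_contra! hcon
  refine hB (measure_eq_zero_iff_ae_notMem.2 ?_)
  have h1 : ∀ᵐ x ∂oneSidedMeasure a, ∀ n : ℕ, 1 ≤ n → x ∉ A ∩ odometer^[n] ⁻¹' A ∩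
      {x | |birkhoffSum odometer (logRnDeriv odometer (oneSidedMeasure a)) n x - t| < ε} :=
    ae_all_iff.2 fun n => by
      by_cases hn : 1 ≤ n
      · filter_upwards [measure_eq_zero_iff_ae_notMem.1 (le_antisymm (hcon n hn) bot_le)]
          with x hx _ using hx
      · exact ae_of_all _ fun x hn' => absurd hn' hn
  filter_upwards [h1, ae_exists_odometer_iterate_eq_flipOn h] with x hx1 hx2 hxB
  obtain ⟨hA, hfA, hxj, hE⟩ := hBA x hxB
  obtain ⟨n, hn, hn1, hn2⟩ := hx2 G j hj hG hxj
  refine hx1 n hn ⟨⟨hA, ?_⟩, ?_⟩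
  · rwa [mem_preimage, hn1]
  · rw [mem_ofPred_eq, hn2]
    exact hE

end Cocycle

/-! ### First crossings and reflection -/

section Crossing

variable {ι : Type*} [LinearOrder ι] (b : ι → Ioo (-1 : ℝ) 1)

/-- The configurations whose partial energies over `F` reach the level `t` first at `k`. -/
def crossing (F : Finset ι) (t : ℝ) (k : ι) : Set (ι → Fin 2) :=
  {x | t ≤ energy b (F.filter (· ≤ k)) x ∧ ∀ i ∈ F, i < k → energy b (F.filter (· ≤ i)) x < t}

theorem measurableSet_crossing (F : Finset ι) (t : ℝ) (k : ι) :
    MeasurableSet (crossing b F t k) := by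
  have : crossing b F t k = {x | t ≤ energy b (F.filter (· ≤ k)) x} ∩
      ⋂ i ∈ F, ⋂ (_ : i < k), {x | energy b (F.filter (· ≤ i)) x < t} := by
    ext x
    simp [crossing]
  rw [this]
  exact (measurableSet_le measurable_const (measurable_energy b _)).inter
    (F.measurableSet_biInter fun i _ => MeasurableSet.iInter fun _ =>
      measurableSet_lt (measurable_energy b _) measurable_const)

theorem pairwiseDisjoint_crossing (F : Finset ι) (t : ℝ) :
    (F : Set ι).PairwiseDisjoint (crossing b F t) := by
  intro k hk l hl hkl
  refine Set.disjoint_left.2 fun x hx hx' => ?_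
  rcases lt_or_gt_of_ne hkl with h | h
  · exact absurd hx.1 (not_le.2 (hx'.2 k hk h))
  · exact absurd hx'.1 (not_le.2 (hx.2 l hl h))

theorem exists_mem_crossing {F : Finset ι} (hF : F.Nonempty) {t : ℝ} {x : ι → Fin 2}
    (h : t ≤ energy b F x) : ∃ k ∈ F, x ∈ crossing b F t k := by
  let C := F.filter fun k => t ≤ energy b (F.filter (· ≤ k)) x
  have hC : C.Nonempty := by
    refine ⟨F.max' hF, Finset.mem_filter.2 ⟨F.max'_mem hF, ?_⟩⟩
    rwa [Finset.filter_true_of_mem fun k hk => F.le_max' k hk]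
  have h1 := Finset.mem_filter.1 (C.min'_mem hC)
  refine ⟨C.min' hC, h1.1, h1.2, fun i hi hi' => ?_⟩
  by_contra hcon
  exact absurd (C.min'_le i (Finset.mem_filter.2 ⟨hi, not_lt.1 hcon⟩)) (not_le.2 hi')

/-- The overshoot is at most one step. If `k` is the first element of `F`, the preceding energy is
the empty sum, whence `0 ≤ t`. -/
theorem energy_lt_of_mem_crossing {F : Finset ι} {t ε : ℝ} (ht : 0 ≤ t)
    (hε : ∀ k ∈ F, |logOdds (b k)| < ε) {k : ι} (hk : k ∈ F) {x : ι → Fin 2}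
    (hx : x ∈ crossing b F t k) : energy b (F.filter (· ≤ k)) x < t + ε := by
  have h1 : F.filter (· ≤ k) = insert k (F.filter (· < k)) := by
    ext i
    simp only [Finset.mem_filter, Finset.mem_insert, le_iff_lt_or_eq]
    constructor
    · rintro ⟨hi, h | h⟩
      · exact Or.inr ⟨hi, h⟩
      · exact Or.inl h
    · rintro (rfl | ⟨hi, h⟩)
      · exact ⟨hk, Or.inr rfl⟩
      · exact ⟨hi, Or.inl h⟩
  have h2 : energy b (F.filter (· < k)) x ≤ t := by
    rcases (F.filter (· < k)).eq_empty_or_nonempty with h | h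
    · rw [h, energy, Finset.sum_empty]
      exact ht
    · have hm := Finset.mem_filter.1 ((F.filter (· < k)).max'_mem h)
      have h3 : F.filter (· < k) = F.filter (· ≤ (F.filter (· < k)).max' h) := by
        ext i
        constructor
        · intro hi
          exact Finset.mem_filter.2 ⟨(Finset.mem_filter.1 hi).1, Finset.le_max' _ i hi⟩
        · intro hi
          rw [Finset.mem_filter] at hi
          exact Finset.mem_filter.2 ⟨hi.1, hi.2.trans_lt hm.2⟩
      rw [h3]
      exact (hx.2 _ hm.1 hm.2).le
  have h3 : |logOdds (b k) * spin (x k)| < ε := by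
    rw [abs_mul, abs_spin, mul_one]
    exact hε k hk
  rw [h1]
  unfold energy at h2 ⊢
  rw [Finset.sum_insert (by simp)]
  linarith [(abs_lt.1 h3).2]

/-- The event depends only on the coordinates of `F` up to `k`, which are flipped twice. Hence the
images of different crossing events under their different flips lie in the disjoint sets `flipOn F
⁻¹' crossing b F t k`. -/
theorem flipOn_flipOn_mem_crossing {F G : Finset ι} {t : ℝ} {k : ι}
    (hG : F.filter (· ≤ k) ⊆ G) {x : ι → Fin 2} (hx : x ∈ crossing b F t k) :
    flipOn F (flipOn G x) ∈ crossing b F t k := by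
  have h : ∀ i ≤ k, energy b (F.filter (· ≤ i)) (flipOn F (flipOn G x)) =
      energy b (F.filter (· ≤ i)) x := by
    intro i hi
    rw [energy_flipOn_of_subset b (Finset.filter_subset _ _), energy_flipOn_of_subset b, neg_neg]
    refine subset_trans (fun j hj => ?_) hG
    rw [Finset.mem_filter] at hj ⊢
    exact ⟨hj.1, hj.2.trans hi⟩
  refine ⟨(h k le_rfl).symm ▸ hx.1, fun i hi hik => ?_⟩
  rw [h i hik.le]
  exact hx.2 i hi hik

theorem abs_energy_insert_sub_lt {F : Finset ι} {t ε : ℝ} (ht : 0 ≤ t)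
    (hε : ∀ k ∈ F, |logOdds (b k)| < ε) {j : ι} (hj : j ∉ F) (hjε : |logOdds (b j)| < ε) {k : ι}
    (hk : k ∈ F) {x : ι → Fin 2} (hx : x ∈ crossing b F t k) :
    |energy b (insert j (F.filter (· ≤ k))) x - t| < 2 * ε := by
  have h1 := energy_lt_of_mem_crossing b ht hε hk hx
  have h2 := hx.1
  have h3 : |logOdds (b j) * spin (x j)| < ε := by
    rwa [abs_mul, abs_spin, mul_one]
  rw [abs_lt] at h3 ⊢
  unfold energy at *
  rw [Finset.sum_insert fun h => hj (Finset.mem_filter.1 h).1]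
  constructor <;> linarith

/-- Reflecting the configurations at the crossing of a level does not increase the measure of
sets by more than a bounded factor. -/
theorem sum_measure_crossing_inter_preimage_le {F : Finset ι} {t ε : ℝ} (ht : 0 ≤ t)
    (hε : ∀ k ∈ F, |logOdds (b k)| < ε) {j : ι} (hj : j ∉ F) (hjε : |logOdds (b j)| < ε)
    {D : Set (ι → Fin 2)} (hD : MeasurableSet D) :
    ∑ k ∈ F, Measure.infinitePi (fun k => coin (b k))
        (crossing b F t k ∩ flipOn (insert j (F.filter (· ≤ k))) ⁻¹' D) ≤
      ENNReal.ofReal (Real.exp (t + 2 * ε)) * Measure.infinitePi (fun k => coin (b k)) D := by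
  set P := Measure.infinitePi fun k => coin (b k)
  have hm : ∀ k, MeasurableSet (flipOn F ⁻¹' crossing b F t k ∩ D) := fun k =>
    (measurable_flipOn F (measurableSet_crossing b F t k)).inter hD
  have h1 : ∀ k ∈ F, P (crossing b F t k ∩ flipOn (insert j (F.filter (· ≤ k))) ⁻¹' D) ≤
      ENNReal.ofReal (Real.exp (t + 2 * ε)) * P (flipOn F ⁻¹' crossing b F t k ∩ D) := by
    intro k hk
    set G := insert j (F.filter (· ≤ k)) with hG
    have hGs : F.filter (· ≤ k) ⊆ G := Finset.subset_insert _ _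
    calc P (crossing b F t k ∩ flipOn G ⁻¹' D)
        ≤ P (flipOn G ⁻¹' (flipOn F ⁻¹' crossing b F t k ∩ D)) :=
          measure_mono fun x hx => ⟨flipOn_flipOn_mem_crossing b hGs hx.1, hx.2⟩
      _ = ∫⁻ y in flipOn F ⁻¹' crossing b F t k ∩ D,
            ENNReal.ofReal (Real.exp (-energy b G y)) ∂P := by
          rw [← Measure.map_apply (measurable_flipOn G) (hm k), map_flipOn,
            withDensity_apply _ (hm k)]
      _ ≤ ∫⁻ _ in flipOn F ⁻¹' crossing b F t k ∩ D,
            ENNReal.ofReal (Real.exp (t + 2 * ε)) ∂P := by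
          refine setLIntegral_mono' (hm k) fun y hy => ?_
          refine ENNReal.ofReal_le_ofReal (Real.exp_le_exp.2 ?_)
          -- Flipping by `G` or by `F` has the same effect on the coordinates of `F` up to `k`; this
          -- bounds the density `exp (-energy G y) = exp (energy G (flipOn G y))`.
          have h2 : flipOn G y ∈ crossing b F t k := by
            have h3 := flipOn_flipOn_mem_crossing b hGs (x := flipOn F y) hy.1
            have h4 : ∀ i ≤ k, energy b (F.filter (· ≤ i)) (flipOn G y) =
                energy b (F.filter (· ≤ i)) (flipOn F y) := by
              intro i hi
              rw [energy_flipOn_of_subset b (Finset.filter_subset _ _),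
                energy_flipOn_of_subset b]
              refine subset_trans (fun j hj => ?_) hGs
              rw [Finset.mem_filter] at hj ⊢
              exact ⟨hj.1, hj.2.trans hi⟩
            have hy1 : flipOn F y ∈ crossing b F t k := hy.1
            refine ⟨(h4 k le_rfl).symm ▸ hy1.1, fun i hi hik => ?_⟩
            rw [h4 i hik.le]
            exact hy1.2 i hi hik
          have h3 := abs_energy_insert_sub_lt b ht hε hj hjε hk h2
          rw [← hG, energy_flipOn_of_subset b (Finset.Subset.refl G)] at h3
          linarith [(abs_lt.1 h3).2]
      _ = _ := setLIntegral_const _ _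
  calc _ ≤ ∑ k ∈ F, ENNReal.ofReal (Real.exp (t + 2 * ε)) *
        P (flipOn F ⁻¹' crossing b F t k ∩ D) := Finset.sum_le_sum h1
    _ = ENNReal.ofReal (Real.exp (t + 2 * ε)) *
        P (⋃ k ∈ F, flipOn F ⁻¹' crossing b F t k ∩ D) := by
        rw [← Finset.mul_sum, measure_biUnion_finset _ fun k _ => hm k]
        intro k hk l hl hkl
        exact ((pairwiseDisjoint_crossing b F t hk hl hkl).preimage _).mono
          inter_subset_left inter_subset_left
    _ ≤ _ := by
        gcongr
        exact iUnion₂_subset fun k _ => inter_subset_right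

end Crossing

/-! ### Independence over disjoint finite sets of coordinates -/

section Independence

variable {ι : Type*} (b : ι → Ioo (-1 : ℝ) 1)

theorem eq_cylinder_of_forall {I : Finset ι} {E : Set (ι → Fin 2)}
    (hE : ∀ x y, (∀ k ∈ I, x k = y k) → x ∈ E → y ∈ E) :
    E = cylinder I (I.restrict '' E) := by
  ext y
  constructor
  · intro hy
    exact ⟨y, hy, rfl⟩
  · rintro ⟨x, hx, hxy⟩
    exact hE x y (fun k hk => congrFun hxy ⟨k, hk⟩) hx

theorem measure_inter_of_forall {I J : Finset ι} (hIJ : Disjoint I J) {E D : Set (ι → Fin 2)}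
    (hE : ∀ x y, (∀ k ∈ I, x k = y k) → x ∈ E → y ∈ E)
    (hD : ∀ x y, (∀ k ∈ J, x k = y k) → x ∈ D → y ∈ D) :
    Measure.infinitePi (fun k => coin (b k)) (E ∩ D) =
      Measure.infinitePi (fun k => coin (b k)) E * Measure.infinitePi (fun k => coin (b k)) D := by
  rw [eq_cylinder_of_forall hE, eq_cylinder_of_forall hD]
  exact measure_inter_of_disjoint b hIJ (Set.toFinite _).measurableSet
    (Set.toFinite _).measurableSet

theorem energy_congr {F : Finset ι} {x y : ι → Fin 2} (h : ∀ k ∈ F, x k = y k) :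
    energy b F x = energy b F y :=
  Finset.sum_congr rfl fun k hk => by rw [h k hk]

/-- A lower bound for the probability that the energy over `F` is large and `x j` is
prescribed. -/
theorem quarter_mul_half_le_measure {F : Finset ι} {j : ι} (hj : j ∉ F) (i : Fin 2)
    (hbj : |(b j : ℝ)| ≤ 1 / 2) {t : ℝ} (hF : t + 2 ≤ ∑ k ∈ F, (b k : ℝ) ^ 2) :
    ENNReal.ofReal (1 / 8) ≤
      Measure.infinitePi (fun k => coin (b k)) ({x | x j = i} ∩ {x | t ≤ energy b F x}) := by
  set P := Measure.infinitePi fun k => coin (b k)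
  have h1 : ENNReal.ofReal (1 / 4) ≤ P {x | x j = i} := by
    have : P {x | x j = i} = coin (b j) {i} := by
      rw [← Measure.infinitePi_map_eval (fun k => coin (b k)) j,
        Measure.map_apply (measurable_pi_apply j) (measurableSet_singleton i)]
      rfl
    rw [this, coin_singleton]
    refine ENNReal.ofReal_le_ofReal ?_
    have h2 : |(b j : ℝ) * spin i| ≤ 1 / 2 := by rwa [abs_mul, abs_spin, mul_one]
    linarith [(abs_le.1 h2).1]
  have h2 : ENNReal.ofReal (1 / 2) ≤ P {x | t ≤ energy b F x} := by
    have h3 : {x | t ≤ energy b F x} = {x | energy b F x < t}ᶜ := by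
      ext x
      simp
    have h4 : P {x | energy b F x < t} ≤ ENNReal.ofReal (1 / 2) := by
      -- The surplus `2` in `hF` makes the Chernoff exponent at most `-1`, and `exp (-1) ≤ 1/2`.
      refine (measure_energy_lt_le b F t).trans (ENNReal.ofReal_le_ofReal ?_)
      calc Real.exp (t / 2 - (∑ k ∈ F, (b k : ℝ) ^ 2) / 2) ≤ Real.exp (-1) :=
            Real.exp_le_exp.2 (by linarith)
        _ ≤ 1 / 2 := by
            rw [Real.exp_neg, one_div]
            exact inv_anti₀ two_pos (by linarith [Real.add_one_le_exp (1 : ℝ)])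
    rw [h3, prob_compl_eq_one_sub (measurableSet_lt (measurable_energy b F) measurable_const)]
    refine le_trans (le_of_eq ?_) (tsub_le_tsub_left h4 1)
    rw [← ENNReal.ofReal_one, ← ENNReal.ofReal_sub _ (by norm_num)]
    norm_num
  rw [measure_inter_of_forall b (I := {j}) (J := F) (by simpa using hj)]
  · calc ENNReal.ofReal (1 / 8) = ENNReal.ofReal (1 / 4) * ENNReal.ofReal (1 / 2) := by
          rw [← ENNReal.ofReal_mul (by norm_num)]
          norm_num
      _ ≤ _ := mul_le_mul' h1 h2
  · intro x y h hx
    exact (h j (by simp)).symm.trans hx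
  · intro x y h hx
    rw [mem_ofPred_eq] at hx ⊢
    rwa [← energy_congr b h]

end Independence

/-! ### Every real number is an essential value -/

section EssentialValues

variable {a : ℕ+ → Ioo (-1 : ℝ) 1}

/-- Removing the finitely many indices in `I` does not affect divergence. -/
theorem exists_finset_le_sum_sq {η : ℝ}
    (h : ¬ Summable fun n : ℕ => if |(a n.succPNat : ℝ)| ≤ η then (a n.succPNat : ℝ) ^ 2 else 0)
    (I : Finset ℕ+) (R : ℝ) : ∃ F : Finset ℕ+, Disjoint I F ∧ (∀ k ∈ F, |(a k : ℝ)| ≤ η) ∧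
      R < ∑ k ∈ F, (a k : ℝ) ^ 2 := by
  let p : ℕ → Prop := fun n => |(a n.succPNat : ℝ)| ≤ η ∧ n.succPNat ∉ I
  classical
  have h1 : ¬ Summable fun n : ℕ => if p n then (a n.succPNat : ℝ) ^ 2 else 0 := by
    refine fun hs => h (hs.congr_cofinite ?_)
    have h2 : ∀ᶠ n : ℕ in cofinite, n.succPNat ∉ I :=
      Nat.succPNat_injective.tendsto_cofinite.eventually I.eventually_cofinite_notMem
    filter_upwards [h2] with n hn
    simp [p, hn]
  obtain ⟨s, hs⟩ : ∃ s : Finset ℕ, R < ∑ n ∈ s, if p n then (a n.succPNat : ℝ) ^ 2 else 0 := by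
    by_contra! hcon
    refine h1 (summable_of_sum_le (fun n => ?_) hcon)
    split_ifs <;> positivity
  refine ⟨(s.filter p).map ⟨Nat.succPNat, Nat.succPNat_injective⟩, ?_, ?_, ?_⟩
  · refine Finset.disjoint_right.2 fun k hk => ?_
    obtain ⟨n, hn, rfl⟩ := Finset.mem_map.1 hk
    exact (Finset.mem_filter.1 hn).2.2
  · intro k hk
    obtain ⟨n, hn, rfl⟩ := Finset.mem_map.1 hk
    exact (Finset.mem_filter.1 hn).2.1
  · rw [Finset.sum_map, Finset.sum_filter]
    exact hs

theorem spin_mul_mem_essentialValues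
    (hf : ∀ ε > 0, ∃ᶠ n : ℕ in atTop, |(a n.succPNat : ℝ)| < ε)
    (hs : ∀ η > 0, ¬ Summable fun n : ℕ =>
      if |(a n.succPNat : ℝ)| ≤ η then (a n.succPNat : ℝ) ^ 2 else 0)
    {t : ℝ} (ht : 0 ≤ t) (i : Fin 2) :
    spin i * t ∈ essentialValues odometer (oneSidedMeasure a)
      (logRnDeriv odometer (oneSidedMeasure a)) := by
  intro ε' hε' A hA hA0
  set μ := oneSidedMeasure a with hμ
  have : IsProbabilityMeasure μ := inferInstanceAs (IsProbabilityMeasure (oneSidedMeasure a))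
  obtain ⟨ε, hε, rfl⟩ : ∃ ε, 0 < ε ∧ 2 * ε = ε' := ⟨ε' / 2, by positivity, by ring⟩
  obtain ⟨η, hη, hlog⟩ : ∃ η > 0, ∀ q : ℝ, |q| < η → |logOdds q| < ε := by
    simpa using Metric.continuousAt_iff.1 continuousAt_logOdds_zero ε hε
  set c : ℝ := Real.exp (t + 2 * ε)
  have hc : 0 < c := Real.exp_pos _
  have hAr : 0 < μ.real A := ENNReal.toReal_pos hA0.ne' (measure_ne_top μ A)
  -- If no flip returned to `A`, then `μ C / 8 ≤ (1 + c) * μ (C \ A)`, hence `μ A ≤ (1 + 8 * (1 +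
  -- c)) * μ (symmDiff C A)`; the tolerance is chosen to contradict this.
  obtain ⟨I, S, hS, hC⟩ := exists_cylinder_symmDiff_lt μ hA
    (ε := ENNReal.ofReal (μ.real A / (1 + 8 * (1 + c)))) (by positivity)
  set C : Set (ℕ+ → Fin 2) := cylinder I S
  have hCm : MeasurableSet C := MeasurableSet.cylinder (α := fun _ => Fin 2) I hS
  obtain ⟨F, hIF, hFη, hFs⟩ := exists_finset_le_sum_sq (hs (η / 2) (by positivity)) I (t + 2)
  have hFε : ∀ k ∈ F, |logOdds (a k)| < ε := fun k hk =>
    hlog _ ((hFη k hk).trans_lt (by linarith))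
  have hFn : F.Nonempty := by
    by_contra hF
    rw [Finset.not_nonempty_iff_eq_empty.1 hF, Finset.sum_empty] at hFs
    linarith
  -- The coordinate `j` is the leading flipped digit and sets the direction in the orbit. Bias below
  -- `η` keeps its energy below `ε`; bias below `1/2` gives each symbol mass at least `1/4`.
  obtain ⟨j, hj, hjI⟩ : ∃ j : ℕ+, |(a j : ℝ)| < min η (1 / 2) ∧ ∀ k ∈ I ∪ F, k < j := by
    obtain ⟨n, hn, hn'⟩ := frequently_atTop.1 (hf (min η (1 / 2)) (by positivity))
      (∑ k ∈ I ∪ F, (k : ℕ))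
    refine ⟨n.succPNat, hn', fun k hk => ?_⟩
    have := Finset.single_le_sum (f := fun k : ℕ+ => (k : ℕ)) (fun _ _ => Nat.zero_le _) hk
    rw [← PNat.coe_lt_coe, Nat.succPNat_coe]
    omega
  have hjη : |logOdds (a j)| < ε := hlog _ (hj.trans_le (min_le_left _ _))
  have hjF : j ∉ F := fun h => lt_irrefl _ (hjI j (Finset.mem_union_right _ h))
  have hjI' : j ∉ I := fun h => lt_irrefl _ (hjI j (Finset.mem_union_left _ h))
  let G : ℕ+ → Finset ℕ+ := fun k => insert j (F.filter (· ≤ k))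
  have hGj : ∀ k, ∀ l ∈ G k, l ≤ j := by
    intro k l hl
    rcases Finset.mem_insert.1 hl with rfl | hl
    · exact le_rfl
    · exact (hjI l (Finset.mem_union_right _ (Finset.mem_filter.1 hl).1)).le
  have hGC : ∀ k x, x ∈ C → flipOn (G k) x ∈ C := by
    intro k x hx
    have : I.restrict (flipOn (G k) x) = I.restrict x := by
      funext l
      refine if_neg fun hl => ?_
      rcases Finset.mem_insert.1 hl with h | h
      · exact hjI' (h ▸ l.2)
      · exact Finset.disjoint_left.1 hIF l.2 (Finset.mem_filter.1 h).1
    rw [mem_cylinder, this]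
    exact hx
  obtain ⟨k, hk, hpos⟩ : ∃ k ∈ F,
      μ (A ∩ {x | x j = i} ∩ crossing a F t k ∩ flipOn (G k) ⁻¹' A) ≠ 0 := by
    by_contra! hcon
    -- A point of this set lies outside `A`, or its flip stays in `C` but misses `A`, or it belongs
    -- to one of the return sets assumed null.
    have hup : μ (C ∩ ({x | x j = i} ∩ {x | t ≤ energy a F x})) ≤
        μ (C \ A) + ENNReal.ofReal c * μ (C \ A) := by
      calc _ ≤ μ (C \ A ∪ (⋃ k ∈ F, crossing a F t k ∩ flipOn (G k) ⁻¹' (C \ A)) ∪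
            ⋃ k ∈ F, A ∩ {x | x j = i} ∩ crossing a F t k ∩ flipOn (G k) ⁻¹' A) := by
            refine measure_mono fun x hx => ?_
            by_cases hxA : x ∈ A
            · obtain ⟨k, hk, hxk⟩ := exists_mem_crossing a hFn hx.2.2
              by_cases hxG : flipOn (G k) x ∈ A
              · exact Or.inr (mem_iUnion₂.2 ⟨k, hk, ⟨⟨hxA, hx.2.1⟩, hxk⟩, hxG⟩)
              · exact Or.inl (Or.inr (mem_iUnion₂.2 ⟨k, hk, hxk, hGC k x hx.1, hxG⟩))
            · exact Or.inl (Or.inl ⟨hx.1, hxA⟩)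
        _ ≤ μ (C \ A) + ∑ k ∈ F, μ (crossing a F t k ∩ flipOn (G k) ⁻¹' (C \ A)) +
            ∑ k ∈ F, μ (A ∩ {x | x j = i} ∩ crossing a F t k ∩ flipOn (G k) ⁻¹' A) := by
            refine (measure_union_le _ _).trans (add_le_add ((measure_union_le _ _).trans ?_) ?_)
            · exact add_le_add le_rfl (measure_biUnion_finset_le _ _)
            · exact measure_biUnion_finset_le _ _
        _ ≤ _ := by
            rw [Finset.sum_eq_zero hcon, add_zero]
            exact add_le_add le_rfl (sum_measure_crossing_inter_preimage_le a ht hFε hjF hjη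
              (hCm.diff hA))
    have hlow : ENNReal.ofReal (1 / 8) * μ C ≤
        μ (C ∩ ({x | x j = i} ∩ {x | t ≤ energy a F x})) := by
      have h1 : μ (C ∩ ({x | x j = i} ∩ {x | t ≤ energy a F x})) =
          μ C * μ ({x | x j = i} ∩ {x | t ≤ energy a F x}) := by
        refine measure_inter_of_forall a (I := I) (J := insert j F) ?_ ?_ ?_
        · exact Finset.disjoint_insert_right.2 ⟨hjI', hIF⟩
        · intro x y h hx
          have : I.restrict x = I.restrict y := funext fun l => h l l.2
          rw [mem_cylinder, ← this]
          exact hx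
        · intro x y h hx
          refine ⟨(h j (Finset.mem_insert_self _ _)).symm.trans hx.1, ?_⟩
          rw [mem_ofPred_eq, ← energy_congr a fun k hk => h k (Finset.mem_insert_of_mem hk)]
          exact hx.2
      rw [h1, mul_comm]
      exact mul_le_mul' le_rfl
        (quarter_mul_half_le_measure a hjF i (hj.le.trans (min_le_right _ _)) hFs.le)
    have h1 : 1 / 8 * μ.real C ≤ (1 + c) * μ.real (C \ A) := by
      have h2 := ENNReal.toReal_mono (by finiteness) (hlow.trans hup)
      rw [ENNReal.toReal_add (by finiteness) (by finiteness), ENNReal.toReal_mul,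
        ENNReal.toReal_mul, ENNReal.toReal_ofReal (by norm_num), ENNReal.toReal_ofReal hc.le] at h2
      change 1 / 8 * μ.real C ≤ μ.real (C \ A) + c * μ.real (C \ A) at h2
      linarith
    have h2 : μ.real (symmDiff C A) < μ.real A / (1 + 8 * (1 + c)) := by
      rw [← ENNReal.toReal_ofReal (show 0 ≤ μ.real A / (1 + 8 * (1 + c)) by positivity)]
      exact ENNReal.toReal_strict_mono ENNReal.ofReal_ne_top hC
    have h3 : μ.real (C \ A) ≤ μ.real (symmDiff C A) := measureReal_mono subset_union_left
    have h4 : μ.real A ≤ μ.real (symmDiff C A) + μ.real C := by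
      refine (measureReal_mono (s₂ := symmDiff C A ∪ C) fun x hx => ?_).trans
        (measureReal_union_le _ _)
      by_cases hxC : x ∈ C
      · exact Or.inr hxC
      · exact Or.inl (Or.inr ⟨hx, hxC⟩)
    rw [lt_div_iff₀ (by positivity)] at h2
    nlinarith [mul_le_mul_of_nonneg_left h3 hc.le]
  have hB : MeasurableSet (A ∩ {x | x j = i} ∩ crossing a F t k ∩ flipOn (G k) ⁻¹' A) :=
    ((hA.inter (measurableSet_eq_fun (measurable_pi_apply j) measurable_const)).inter
      (measurableSet_crossing a F t k)).inter (measurable_flipOn _ hA)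
  have hjG : j ∈ G k := Finset.mem_insert_self _ _
  have hE : ∀ x ∈ crossing a F t k, |energy a (G k) x - t| < 2 * ε := fun x hx =>
    abs_energy_insert_sub_lt a ht hFε hjF hjη hk hx
  have hi : i = 0 ∨ i = 1 := by omega
  rcases hi with rfl | rfl
  · refine exists_measure_birkhoffSum_pos (hf _ one_half_pos) hpos hjG (hGj k) fun x hx =>
      ⟨hx.1.1.1, hx.2, hx.1.1.2, ?_⟩
    have h1 := hE x hx.1.2
    rw [← abs_neg] at h1
    convert h1 using 2
    rw [spin_zero]
    ring
  -- With `x_j = 1` the flip runs backwards, so the roles are exchanged: the flipped point has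
  -- `j`-th digit `0` and energy near `-t`, and its forward iterate is the original point.
  · have hpos' : μ (flipOn (G k) ⁻¹'
        (A ∩ {x | x j = 1} ∩ crossing a F t k ∩ flipOn (G k) ⁻¹' A)) ≠ 0 := by
      intro h0
      have h1 := measure_flipOn_preimage_eq_zero a (G k) (measurable_flipOn (G k) hB) h0
      rw [← preimage_comp, show flipOn (G k) ∘ flipOn (G k) = id from
        funext fun x => flipOn_flipOn _ x, preimage_id] at h1
      exact hpos h1
    refine exists_measure_birkhoffSum_pos (hf _ one_half_pos) hpos' hjG (hGj k) fun x hx =>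
      ⟨?_, hx.1.1.1, ?_, ?_⟩
    · have := hx.2
      rwa [mem_preimage, flipOn_flipOn] at this
    · have h1 : flipOn (G k) x j = 1 := hx.1.1.2
      rw [flipOn, if_pos hjG] at h1
      omega
    · have h1 := hE _ hx.1.2
      rwa [energy_flipOn_of_subset a (Finset.Subset.refl _), ← one_mul t, ← spin_one] at h1

end EssentialValues

theorem mainTheorem5 (a : ℕ+ → Set.Ioo (-1 : ℝ) 1)
    (hns : IsNonsingular fullShift (halfStationaryMeasure a))
    (hcons : Conservative fullShift (halfStationaryMeasure a))
    (hacip : ¬ HasACIP fullShift (halfStationaryMeasure a)) :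
    (∃ n : ℕ → ℕ+, StrictMono n ∧ Tendsto (fun k => (a (n k) : ℝ)) atTop (𝓝 0)) ∧
      IsTypeIIIOne odometer (oneSidedMeasure a) := by
  have hd : ∀ δ > 0, ∀ᶠ n : ℕ in atTop, |(a (n + 1).succPNat : ℝ) - a n.succPNat| < δ :=
    fun δ hδ => eventually_abs_sub_lt_of_isNonsingular hns hδ
  have hf : ∀ ε > 0, ∃ᶠ n : ℕ in atTop, |(a n.succPNat : ℝ)| < ε :=
    fun ε hε => frequently_abs_lt_of_conservative hcons hd hε
  have hs : ∀ η > 0, ¬ Summable fun n : ℕ =>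
      if |(a n.succPNat : ℝ)| ≤ η then (a n.succPNat : ℝ) ^ 2 else 0 := fun η hη h =>
    not_summable_sq hacip (summable_of_tendsto_of_summable_truncated hd hf hη h)
  refine ⟨?_, odometer_isNonsingular (hf _ one_half_pos), odometer_quasiErgodic (hf _ one_half_pos),
    eq_univ_of_forall fun t => ?_⟩
  · obtain ⟨φ, hφ, hφa⟩ := extraction_forall_of_frequently fun n : ℕ =>
      hf (1 / ((n : ℝ) + 1)) Nat.one_div_pos_of_nat
    exact ⟨fun k => (φ k).succPNat, Nat.succPNat_strictMono.comp hφ,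
      squeeze_zero_norm (fun k => (hφa k).le) tendsto_one_div_add_atTop_nhds_zero_nat⟩
  · rcases le_total 0 t with ht | ht
    · simpa using spin_mul_mem_essentialValues hf hs ht 1
    · simpa using spin_mul_mem_essentialValues hf hs (neg_nonneg.2 ht) 0
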